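/- **Links and feasibility.** Let $2<\alpha<6$, $\beta>0$ and $N\ge 0$. A set $L$ of $n$ links in a metric space $(X,d)$ consists of pairs $(s_i,r_i)$, $i=1,\dots,n$, of distinct points (sender and receiver); $l_i=d(s_i,r_i)$ is the length of link $i$, $\Delta=\Delta(L)$ is the ratio of the longest to the shortest length, and $d(i,j)=\min\{d(s_i,r_j),d(s_j,r_i),d(s_i,s_j),d(r_i,r_j)\}$. A subset $S\subseteq L$ is *feasible* if there are powers $P(i)>0$ such that $$\frac{P(i)}{l_i^\alpha}\ \ge\ \beta\Big(\sum_{j\in S\setminus\{i\}}\frac{P(j)}{d(s_j,r_i)^\alpha}+N\Big)\qquad\text{for all } i\in S$$ (the right-hand side being infinite if $d(s_j,r_i)=0$ for some $j\in S\setminus\{i\}$). *Scheduling* asks for a partition of $L$ into the minimum number $OPTS(L)$ of feasible sets. *Weighted capacity* asks, given weights $\omega_i>0$, for a feasible $S\subseteq L$ of maximum weight $\omega(S)=\sum_{i\in S}\omega_i$. **Metric space.** Let $0\le m<\alpha$. The doubling dimension of $X$ is the infimum of the $\delta>0$ for which there is a constant $C_\delta$ such that, for all $0<\varepsilon\le1$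 and $r>0$, every ball of radius $r$ has at most $C_\delta\,\varepsilon^{-\delta}$ points of mutual distance at least $\varepsilon r$. We consider spaces of doubling dimension at most $m$, the bound holding for each $\delta>m$ with a prescribed constant $C_\delta$. **Conflict graph.** Let $\widetilde{\log}(x)=\max\{(\log_2 x)^{2/(\alpha-m)},1\}$ for $x\ge1$. In $\mathcal G_{\gamma\widetilde{\log}}(L)$, whose vertices are the links, distinct links $i,j$ are adjacent if and only if $$\frac{d(i,j)}{l_{\min}}\le\gamma\,\widetilde{\log}\Big(\frac{l_{\max}}{l_{\min}}\Big),\qquad l_{\min}=\min\{l_i,l_j\},\ l_{\max}=\max\{l_i,l_j\}.$$ Let $\log^*x$ be the least $c\ge1$ such that the $c$-fold iterated base-2 logarithm of $x$ is at most $2$ (so $\log^* x=1$ for $1\le x\le2$). **Computation.** Algorithms are programs of a real RAM: unit-cost exact arithmetic, comparison, $\exp$ and $\log$ on real numbers, and addition, truncated subtraction and comparison of natural numbers, which also serve as addresses. The input consists of $n$, the distances between the $2n$ senders and receivers, the weights (for weighted capacity), and the constants $\alpha,m,\gamma$. **Theorem.** There are two such programs and a polynomial $p$ with the following property. For all $\alpha,\beta,m$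 and $(C_\delta)_{\delta>m}$ as above there are constants $\gamma\ge1$ and $K$, depending only on these data, such that for every metric space $X$ of doubling dimension at most $m$ with constants $C_\delta$, every $N\ge0$ and every set $L$ of $n$ links in $X$: 1. *(Scheduling)* The first program halts after at most $p(n)$ steps and outputs a proper colouring of $\mathcal G_{\gamma\widetilde{\log}}(L)$ with at most $K\cdot\chi(\mathcal G_{\gamma\widetilde{\log}}(L))$ colours. Every colour class is feasible, and the number of colours is at most $K\cdot\log^*\Delta\cdot OPTS(L)$. 2. *(Weighted capacity)* For all positive weights $\omega$, the second program halts after at most $p(n)$ steps and outputs an independent set $S$ of $\mathcal G_{\gamma\widetilde{\log}}(L)$ with $\omega(T)\le K\,\omega(S)$ for every independent set $T$ of that graph. The set $S$ is feasible, and $\omega(T)\le K\cdot\log^*\Delta\cdot\omega(S)$ for every feasible $T\subseteq L$. -/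

import Mathlib

/-! ### Real RAM

A uniform machine model for computation with exact real numbers: a structured imperative language
whose store holds one-dimensional arrays of natural numbers (a scalar is cell `0` of an array) and
two-dimensional arrays of real numbers. Every array access, every arithmetic operation, every
comparison and every assignment costs one step. The primitives on reals are `+`, `-`, `*`, `/`,
`exp`, `log` and comparison (no rounding); naturals have addition, truncated subtraction and
comparison, and are used for control and as (possibly indirect) addresses. The only constants in a
program are natural numbers. -/

namespace RealRAM

/-- The contents of the memory. -/
structure Store where
  nat : ℕ → ℕ → ℕ
  real : ℕ → ℕ → ℕ → ℝ

/-- Overwrite cell `i` of natural-number array `a`. -/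
def Store.setNat (σ : Store) (a i v : ℕ) : Store where
  nat := Function.update σ.nat a (Function.update (σ.nat a) i v)
  real := σ.real

/-- Overwrite cell `(i, j)` of real array `a`. -/
noncomputable def Store.setReal (σ : Store) (a i j : ℕ) (v : ℝ) : Store where
  nat := σ.nat
  real := Function.update σ.real a
    (Function.update (σ.real a) i (Function.update (σ.real a i) j v))

/-- Natural-number expressions; `get a i` reads cell `i` of array `a`. -/
inductive NExpr where
  | lit (k : ℕ)
  | get (a : ℕ) (i : NExpr)
  | add (x y : NExpr)
  | sub (x y : NExpr)

def NExpr.eval (σ : Store) : NExpr → ℕ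
  | lit k => k
  | get a i => σ.nat a (i.eval σ)
  | add x y => x.eval σ + y.eval σ
  | sub x y => x.eval σ - y.eval σ

/-- Number of operations needed to evaluate an expression. -/
def NExpr.ops : NExpr → ℕ
  | lit _ => 1
  | get _ i => i.ops + 1
  | add x y => x.ops + y.ops + 1
  | sub x y => x.ops + y.ops + 1

/-- Real expressions; `get a i j` reads cell `(i, j)` of array `a`. -/
inductive RExpr where
  | lit (k : ℕ)
  | get (a : ℕ) (i j : NExpr)
  | add (x y : RExpr)
  | sub (x y : RExpr)
  | mul (x y : RExpr)
  | div (x y : RExpr)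
  | exp (x : RExpr)
  | log (x : RExpr)

noncomputable def RExpr.eval (σ : Store) : RExpr → ℝ
  | lit k => (k : ℝ)
  | get a i j => σ.real a (i.eval σ) (j.eval σ)
  | add x y => x.eval σ + y.eval σ
  | sub x y => x.eval σ - y.eval σ
  | mul x y => x.eval σ * y.eval σ
  | div x y => x.eval σ / y.eval σ
  | exp x => Real.exp (x.eval σ)
  | log x => Real.log (x.eval σ)

def RExpr.ops : RExpr → ℕ
  | lit _ => 1
  | get _ i j => i.ops + j.ops + 1
  | add x y => x.ops + y.ops + 1
  | sub x y => x.ops + y.ops + 1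
  | mul x y => x.ops + y.ops + 1
  | div x y => x.ops + y.ops + 1
  | exp x => x.ops + 1
  | log x => x.ops + 1

/-- Tests. -/
inductive Test where
  | natLt (x y : NExpr)
  | natEq (x y : NExpr)
  | realLt (x y : RExpr)
  | not (b : Test)
  | and (b c : Test)

def Test.Holds (σ : Store) : Test → Prop
  | natLt x y => x.eval σ < y.eval σ
  | natEq x y => x.eval σ = y.eval σ
  | realLt x y => x.eval σ < y.eval σ
  | not b => ¬ b.Holds σ
  | and b c => b.Holds σ ∧ c.Holds σ

def Test.ops : Test → ℕ
  | natLt x y => x.ops + y.ops + 1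
  | natEq x y => x.ops + y.ops + 1
  | realLt x y => x.ops + y.ops + 1
  | not b => b.ops + 1
  | and b c => b.ops + c.ops + 1

/-- Programs. -/
inductive Program where
  | skip
  | setNat (a : ℕ) (i e : NExpr)
  | setReal (a : ℕ) (i j : NExpr) (e : RExpr)
  | seq (p q : Program)
  | cond (b : Test) (p q : Program)
  | loop (b : Test) (p : Program)

/-- `Run p σ τ t`: program `p`, started in store `σ`, halts in store `τ` after `t` steps. -/
inductive Run : Program → Store → Store → ℕ → Prop
  | skip (σ : Store) : Run .skip σ σ 1
  | setNat (σ : Store) (a : ℕ) (i e : NExpr) :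
      Run (.setNat a i e) σ (σ.setNat a (i.eval σ) (e.eval σ)) (i.ops + e.ops + 1)
  | setReal (σ : Store) (a : ℕ) (i j : NExpr) (e : RExpr) :
      Run (.setReal a i j e) σ (σ.setReal a (i.eval σ) (j.eval σ) (e.eval σ))
        (i.ops + j.ops + e.ops + 1)
  | seq {p q : Program} {σ τ ρ : Store} {t u : ℕ} :
      Run p σ τ t → Run q τ ρ u → Run (.seq p q) σ ρ (t + u)
  | condTrue {b : Test} {p q : Program} {σ τ : Store} {t : ℕ} :
      b.Holds σ → Run p σ τ t → Run (.cond b p q) σ τ (b.ops + t + 1)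
  | condFalse {b : Test} {p q : Program} {σ τ : Store} {t : ℕ} :
      ¬ b.Holds σ → Run q σ τ t → Run (.cond b p q) σ τ (b.ops + t + 1)
  | loopTrue {b : Test} {p : Program} {σ τ ρ : Store} {t u : ℕ} :
      b.Holds σ → Run p σ τ t → Run (.loop b p) τ ρ u →
        Run (.loop b p) σ ρ (b.ops + t + u + 1)
  | loopFalse {b : Test} {p : Program} {σ : Store} :
      ¬ b.Holds σ → Run (.loop b p) σ σ (b.ops + 1)

/-- Programs are deterministic: the final store and the number of steps are determined. -/
theorem Run.deterministic {p : Program} {σ τ : Store} {t : ℕ} (h : Run p σ τ t) :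
    ∀ {τ' : Store} {t' : ℕ}, Run p σ τ' t' → τ' = τ ∧ t' = t := by
  induction h with
  | skip | setNat | setReal => intro _ _ h'; cases h'; exact ⟨rfl, rfl⟩
  | seq _ _ ih₁ ih₂ =>
      intro _ _ h'
      cases h' with
      | seq h₁ h₂ =>
        obtain ⟨rfl, rfl⟩ := ih₁ h₁
        obtain ⟨rfl, rfl⟩ := ih₂ h₂
        exact ⟨rfl, rfl⟩
  | condTrue hb _ ih | condFalse hb _ ih =>
      intro _ _ h'
      cases h' with
      | condTrue hb' h₁ => first | exact absurd hb' hb | (obtain ⟨rfl, rfl⟩ := ih h₁; exact ⟨rfl, rfl⟩)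
      | condFalse hb' h₁ => first | exact absurd hb hb' | (obtain ⟨rfl, rfl⟩ := ih h₁; exact ⟨rfl, rfl⟩)
  | loopTrue hb _ _ ih₁ ih₂ =>
      intro _ _ h'
      cases h' with
      | loopTrue _ h₁ h₂ =>
        obtain ⟨rfl, rfl⟩ := ih₁ h₁
        obtain ⟨rfl, rfl⟩ := ih₂ h₂
        exact ⟨rfl, rfl⟩
      | loopFalse hb' => exact absurd hb hb'
  | loopFalse hb =>
      intro _ _ h'
      cases h' with
      | loopTrue hb' _ _ => exact absurd hb' hb
      | loopFalse _ => exact ⟨rfl, rfl⟩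

end RealRAM

/-! ### Doubling dimension -/

/-- Every ball of radius `r > 0` has at most `C ε^(-δ)` points of mutual distance at least `ε r`,
for all `0 < ε ≤ 1`. -/
def DoublingBound (X : Type*) [MetricSpace X] (C δ : ℝ) : Prop :=
  ∀ ε : ℝ, 0 < ε → ε ≤ 1 → ∀ r : ℝ, 0 < r → ∀ x : X, ∀ T : Finset X,
    (∀ y ∈ T, y ∈ Metric.ball x r) →
    (∀ y ∈ T, ∀ z ∈ T, y ≠ z → ε * r ≤ dist y z) →
    (T.card : ℝ) ≤ C * ε ^ (-δ)

/-- The doubling dimension: the infimum of the exponents `δ > 0` for which a doubling bound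
holds. -/
noncomputable def doublingDim (X : Type*) [MetricSpace X] : ENNReal :=
  ⨅ (δ : ℝ) (_ : 0 < δ ∧ ∃ C : ℝ, 1 ≤ C ∧ DoublingBound X C δ), ENNReal.ofReal δ

/-- The doubling dimension of `X` is at most `m`, the bound of exponent `δ > m` holding with the
constant `C δ`. (Fixing `C` makes it possible to speak of constants that are uniform over metric
spaces; for a constant function `C` this is the bound of exponent `m` itself.) -/
def DoublingDimLE (X : Type*) [MetricSpace X] (m : ℝ) (C : ℝ → ℝ) : Prop :=
  ∀ δ : ℝ, m < δ → DoublingBound X (C δ) δ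

theorem DoublingBound.mono {X : Type*} [MetricSpace X] {C C' δ δ' : ℝ} (h : DoublingBound X C δ)
    (hC : C ≤ C') (hC' : 0 ≤ C') (hδ : δ ≤ δ') : DoublingBound X C' δ' := by
  intro ε hε hε1 r hr x T h1 h2
  refine (h ε hε hε1 r hr x T h1 h2).trans ?_
  have : ε ^ (-δ) ≤ ε ^ (-δ') := Real.rpow_le_rpow_of_exponent_ge hε hε1 (by linarith)
  exact mul_le_mul hC this (Real.rpow_nonneg hε.le _) hC'

theorem doublingDim_le_iff {X : Type*} [MetricSpace X] {m : ℝ} (hm : 0 ≤ m) :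
    doublingDim X ≤ ENNReal.ofReal m ↔ ∃ C : ℝ → ℝ, DoublingDimLE X m C := by
  constructor
  · intro h
    have key : ∀ δ : ℝ, ∃ C : ℝ, m < δ → DoublingBound X C δ := by
      intro δ
      by_cases hδ : m < δ
      · have hlt : doublingDim X < ENNReal.ofReal δ :=
          h.trans_lt ((ENNReal.ofReal_lt_ofReal_iff (hm.trans_lt hδ)).2 hδ)
        simp only [doublingDim, iInf_lt_iff] at hlt
        obtain ⟨δ', ⟨_, C, hC, hb⟩, hlt⟩ := hlt
        have := (ENNReal.ofReal_lt_ofReal_iff (hm.trans_lt hδ)).1 hlt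
        exact ⟨C, fun _ => hb.mono le_rfl (by linarith) this.le⟩
      · exact ⟨0, fun h => absurd h hδ⟩
    choose C hC using key
    exact ⟨C, hC⟩
  · rintro ⟨C, hC⟩
    refine ENNReal.le_of_forall_pos_le_add ?_
    intro ε hε _
    have hb := hC (m + ε) (by simpa using hε)
    have hpos : (0 : ℝ) < m + ε := by
      have : (0 : ℝ) < ε := by exact_mod_cast hε
      linarith
    have : doublingDim X ≤ ENNReal.ofReal (m + ε) :=
      iInf₂_le (m + ε : ℝ) ⟨hpos, max (C (m + ε)) 1, le_max_right _ _,
        hb.mono (le_max_left _ _) (le_max_of_le_right zero_le_one) le_rfl⟩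
    rwa [ENNReal.ofReal_add hm ε.coe_nonneg, ENNReal.ofReal_coe_nnreal] at this

/-! ### Functions -/

/-- The iterated logarithm (base 2): the least `c ≥ 1` such that the `c`-fold logarithm of `x` is
at most `2`; in particular it is `1` for `1 ≤ x ≤ 2`. -/
noncomputable def logStar (x : ℝ) : ℕ :=
  sInf {c : ℕ | 1 ≤ c ∧ (Real.logb 2)^[c] x ≤ 2}

/-- `max (log₂ x ^ (2 / (α - m))) 1`, for `x ≥ 1`. -/
noncomputable def tlog (α m x : ℝ) : ℝ :=
  max (Real.logb 2 x ^ (2 / (α - m))) 1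

/-! ### Links -/

/-- A set of `n` links in `X`: link `i` goes from the sender `s i` to the receiver `r i`, two
distinct points. -/
structure Links (X : Type*) (n : ℕ) where
  s : Fin n → X
  r : Fin n → X
  ne : ∀ i, s i ≠ r i

namespace Links

variable {X : Type*} [MetricSpace X] {n : ℕ}

/-- The length of link `i`. -/
def len (L : Links X n) (i : Fin n) : ℝ := dist (L.s i) (L.r i)

/-- The ratio of the longest to the shortest link length. -/
noncomputable def ratio (L : Links X n) : ℝ := ⨆ p : Fin n × Fin n, L.len p.1 / L.len p.2

/-- The minimum distance between a node of link `i` and a node of link `j`. -/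
noncomputable def sep (L : Links X n) (i j : Fin n) : ℝ :=
  min (min (dist (L.s i) (L.r j)) (dist (L.s j) (L.r i)))
    (min (dist (L.s i) (L.s j)) (dist (L.r i) (L.r j)))

/-- Links `i` and `j` are `f`-independent. -/
def Indep (L : Links X n) (f : ℝ → ℝ) (i j : Fin n) : Prop :=
  f (max (L.len i) (L.len j) / min (L.len i) (L.len j)) <
    L.sep i j / min (L.len i) (L.len j)

/-- The conflict graph: distinct links are adjacent iff they are not `f`-independent. -/
def conflictGraph (L : Links X n) (f : ℝ → ℝ) : SimpleGraph (Fin n) where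
  Adj i j := i ≠ j ∧ ¬ L.Indep f i j
  symm := ⟨by
    rintro i j ⟨hne, h⟩
    refine ⟨hne.symm, fun h' => h ?_⟩
    unfold Indep sep at *
    rw [max_comm (L.len i), min_comm (L.len i), min_comm (dist (L.s i) (L.r j)),
      dist_comm (L.s i) (L.s j), dist_comm (L.r i) (L.r j)]
    exact h'⟩
  loopless := ⟨fun _ h => h.1 rfl⟩

/-- Feasibility of a set `S` of links under arbitrary power control: some assignment of positive
powers satisfies the SINR condition at every link of `S`, with path loss exponent `α`, threshold
`β` and ambient noise `N`. (A sender located at the receiver of another link of `S` would cause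
infinite interference there, so this is excluded.) -/
def Feasible (L : Links X n) (α β N : ℝ) (S : Finset (Fin n)) : Prop :=
  ∃ P : Fin n → ℝ, (∀ i, 0 < P i) ∧ ∀ i ∈ S,
    (∀ j ∈ S.erase i, 0 < dist (L.s j) (L.r i)) ∧
    β * (∑ j ∈ S.erase i, P j / dist (L.s j) (L.r i) ^ α + N) ≤ P i / L.len i ^ α

/-- `c` is a schedule: links with the same value of `c` share a slot, and each slot is feasible. -/
def IsSchedule (L : Links X n) (α β N : ℝ) {κ : Type*} [DecidableEq κ] (c : Fin n → κ) : Prop :=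
  ∀ k : κ, L.Feasible α β N (Finset.univ.filter fun i => c i = k)

/-- The minimum length of a schedule. -/
noncomputable def optS (L : Links X n) (α β N : ℝ) : ℕ :=
  sInf {k : ℕ | ∃ c : Fin n → Fin k, L.IsSchedule α β N c}

/-- The initial store of the real RAM on a set of `n` links with weights `w`. Natural array `0`
holds `n`. Real array `0` holds the constants `α`, `m`, `γ` in its row `0`; arrays `1`, `2`, `3`
hold the distances sender–sender, sender–receiver and receiver–receiver; array `4` holds the
weights in its column `0`. Everything else is `0`. -/
noncomputable def input (L : Links X n) (w : Fin n → ℝ) (α m γ : ℝ) : RealRAM.Store where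
  nat := fun a i => if a = 0 ∧ i = 0 then n else 0
  real := fun a i j =>
    if a = 0 then
      if i = 0 ∧ j = 0 then α else if i = 0 ∧ j = 1 then m else if i = 0 ∧ j = 2 then γ else 0
    else if a = 4 then
      if h : i < n ∧ j = 0 then w ⟨i, h.1⟩ else 0
    else if h : i < n ∧ j < n then
      if a = 1 then dist (L.s ⟨i, h.1⟩) (L.s ⟨j, h.2⟩)
      else if a = 2 then dist (L.s ⟨i, h.1⟩) (L.r ⟨j, h.2⟩)
      else if a = 3 then dist (L.r ⟨i, h.1⟩) (L.r ⟨j, h.2⟩)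
      else 0
    else 0

end Links

/-- The output of a computation: one natural number per link, in cells `0, …, n - 1` of natural
array `1`. -/
def RealRAM.Store.output (σ : RealRAM.Store) (n : ℕ) (i : Fin n) : ℕ := σ.nat 1 i

open Filter Asymptotics

/-! Three facts about the conflict graph carry the theorem; in each, the constants depend only on
the prescribed data.

Independent sets are feasible once `γ` is large (`exists_feasible_of_indep`). Around a fixed link,
the shorter independent links are sorted dyadically by length and by distance and counted by
packing. The exponent `2 / (α - m)` in `tlog` is what makes the resulting double series converge,
and its prefactor `(2 / γ) ^ α` makes the sum small (`sum_div_dist_le`). Powers are then fixed from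
the longest link downwards, each twice what the longer links demand. The power of a shorter link is
a sum over links longer than it, and the triangle inequality turns its interference into a small
multiple of interference already present, which is absorbed (`feasible_of_sum_le`).

Feasible sets split into `O(log* Δ)` independent sets (`exists_coloring_of_feasible`). Multiplying
the SINR conditions of two mutually close links shows that only boundedly many longer links come
within the length of a given link (`Feasible.card_le`), so boundedly many classes are separated on
the scale of the shorter length. In such a class, the lengths of the longer neighbours of a link,
measured in the length of that link, drop from one to the next by a multiple of `tlog`. Two drops
are at most a logarithm, so there are `O(log* Δ)` of them (`exists_card_longer_le`), and greedy
colouring from long to short applies.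

Independent longer neighbours of a link are bounded in number (`exists_card_indep_longer_le`). Hence
first fit from long to short uses `O(χ)` colours, and the local-ratio method finds an independent
set of weight within a constant factor of the maximum. Combining this with the splitting of feasible
sets costs one factor `log* Δ`.

The two algorithms are written as real RAM programs. A total-correctness calculus `WP`, in which
every loop runs `n` rounds, yields the specifications `IsFirstFit`, `IsResidual`, `IsSelected`
together with a polynomial step count; the approximation proofs use only these specifications. -/

/-! ### Growth of `tlog` and the iterated logarithm. -/

theorem one_le_tlog (α m x : ℝ) : 1 ≤ tlog α m x := le_max_right _ _

theorem tlog_pos (α m x : ℝ) : 0 < tlog α m x := one_pos.trans_le (one_le_tlog α m x)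

theorem tlog_mono {α m x y : ℝ} (hm : m < α) (hx : 1 ≤ x) (hxy : x ≤ y) :
    tlog α m x ≤ tlog α m y := by
  unfold tlog
  have h0 : 0 ≤ Real.logb 2 x := Real.logb_nonneg one_lt_two hx
  have h1 : Real.logb 2 x ≤ Real.logb 2 y :=
    Real.logb_le_logb_of_le one_lt_two (by linarith) hxy
  exact max_le_max (Real.rpow_le_rpow h0 h1 (div_pos two_pos (sub_pos.2 hm)).le) le_rfl

/-- The logarithm of a product is at most twice the larger logarithm, and the other factor on the
right is at least `1`. -/
theorem tlog_mul_le {α m u v : ℝ} (hm : m < α) (hu : 1 ≤ u) (hv : 1 ≤ v) :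
    tlog α m (u * v) ≤ 2 ^ (2 / (α - m)) * (tlog α m u * tlog α m v) := by
  have hp : 0 < 2 / (α - m) := div_pos two_pos (sub_pos.2 hm)
  have h2 : (1 : ℝ) ≤ 2 ^ (2 / (α - m)) := Real.one_le_rpow one_le_two hp.le
  have hu1 := one_le_tlog α m u
  have hv1 := one_le_tlog α m v
  have huv : 1 ≤ tlog α m u * tlog α m v := one_le_mul_of_one_le_of_one_le hu1 hv1
  have hlu : 0 ≤ Real.logb 2 u := Real.logb_nonneg one_lt_two hu
  have hlv : 0 ≤ Real.logb 2 v := Real.logb_nonneg one_lt_two hv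
  refine max_le ?_ (one_le_mul_of_one_le_of_one_le h2 huv)
  rw [Real.logb_mul (by positivity) (by positivity)]
  rcases le_total (Real.logb 2 u) (Real.logb 2 v) with h | h
  · calc (Real.logb 2 u + Real.logb 2 v) ^ (2 / (α - m))
        ≤ (2 * Real.logb 2 v) ^ (2 / (α - m)) :=
          Real.rpow_le_rpow (by positivity) (by linarith) hp.le
      _ = 2 ^ (2 / (α - m)) * Real.logb 2 v ^ (2 / (α - m)) := Real.mul_rpow zero_le_two hlv
      _ ≤ _ := by
        gcongr
        exact (le_max_left _ _).trans (le_mul_of_one_le_left (tlog_pos α m v).le hu1)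
  · calc (Real.logb 2 u + Real.logb 2 v) ^ (2 / (α - m))
        ≤ (2 * Real.logb 2 u) ^ (2 / (α - m)) :=
          Real.rpow_le_rpow (by positivity) (by linarith) hp.le
      _ = 2 ^ (2 / (α - m)) * Real.logb 2 u ^ (2 / (α - m)) := Real.mul_rpow zero_le_two hlu
      _ ≤ _ := by
        gcongr
        exact (le_max_left _ _).trans (le_mul_of_one_le_right (tlog_pos α m u).le hv1)

theorem tlog_isLittleO (α m : ℝ) {s : ℝ} (hs : 0 < s) :
    (fun x => tlog α m x) =o[atTop] fun x => x ^ s := by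
  have h1 : (fun x => Real.logb 2 x ^ (2 / (α - m))) =o[atTop] fun x => x ^ s := by
    have h := (isLittleO_log_rpow_rpow_atTop (2 / (α - m)) hs).const_mul_left
      ((Real.log 2)⁻¹ ^ (2 / (α - m)))
    refine h.congr' ?_ EventuallyEq.rfl
    filter_upwards [eventually_ge_atTop 1] with x hx
    rw [← Real.mul_rpow (inv_nonneg.2 (Real.log_nonneg one_le_two)) (Real.log_nonneg hx),
      Real.logb, div_eq_inv_mul (Real.log x)]
  have h2 : (fun _ : ℝ => (1 : ℝ)) =o[atTop] fun x : ℝ => x ^ s :=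
    (isLittleO_const_left.2 <| Or.inr <|
      tendsto_norm_atTop_atTop.comp (tendsto_rpow_atTop hs))
  refine IsBigO.trans_isLittleO (IsBigO.of_bound 1 ?_) (h1.norm_left.add h2.norm_left)
  filter_upwards with x
  rw [one_mul, Real.norm_of_nonneg (tlog_pos α m x).le, norm_one]
  refine (max_le ?_ ?_).trans (le_abs_self _)
  · exact (le_abs_self _).trans (by simp)
  · simp

theorem exists_mul_tlog_le_rpow (α m A : ℝ) {s : ℝ} (hs : 0 < s) :
    ∃ x₀ : ℝ, 1 ≤ x₀ ∧ ∀ x, x₀ ≤ x → A * tlog α m x ≤ x ^ s := by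
  have h := ((tlog_isLittleO α m hs).const_mul_left A).bound one_pos
  obtain ⟨x₀, h₀⟩ := eventually_atTop.1 h
  refine ⟨max x₀ 1, le_max_right _ _, fun x hx => ?_⟩
  have := h₀ x ((le_max_left _ _).trans hx)
  have hx1 : (1 : ℝ) ≤ x := (le_max_right _ _).trans hx
  rw [one_mul, Real.norm_of_nonneg (Real.rpow_nonneg (by linarith) _)] at this
  exact (le_abs_self _).trans this

/-- With `y = log₂ x` and `p = 2 / (α - m)`, the inner argument is `A * y ^ p ≤ y ^ (2 * p)` for
large `y`, and `A * tlog` grows more slowly than the power `1 / (2 * p)`. This is the hypothesis `g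
∘ g ≤ log₂` of `exists_le_iterate_logb`. -/
theorem exists_mul_tlog_mul_tlog_le {α m A : ℝ} (hm : m < α) (hA : 1 ≤ A) :
    ∃ x₀ : ℝ, 2 < x₀ ∧ ∀ x, x₀ ≤ x → A * tlog α m (A * tlog α m x) ≤ Real.logb 2 x := by
  have hp : 0 < 2 / (α - m) := div_pos two_pos (sub_pos.2 hm)
  set p := 2 / (α - m) with hpdef
  obtain ⟨z₀, hz1, hz⟩ := exists_mul_tlog_le_rpow α m A (s := 1 / (2 * p)) (by positivity)
  have h1 : Tendsto (fun x => Real.logb 2 x) atTop atTop := Real.tendsto_logb_atTop one_lt_two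
  have h2 : Tendsto (fun x => Real.logb 2 x ^ p) atTop atTop := (tendsto_rpow_atTop hp).comp h1
  have h3 := h1.eventually_ge_atTop (max 1 (A ^ (1 / p)))
  have h4 := h2.eventually_ge_atTop z₀
  obtain ⟨x₀, h₀⟩ := eventually_atTop.1 (h3.and h4)
  refine ⟨max x₀ 3, lt_of_lt_of_le (by norm_num) (le_max_right _ _), fun x hx => ?_⟩
  obtain ⟨ha, hb⟩ := h₀ x ((le_max_left _ _).trans hx)
  set y := Real.logb 2 x
  have hy1 : 1 ≤ y := (le_max_left _ _).trans ha
  have hyA : A ^ (1 / p) ≤ y := (le_max_right _ _).trans ha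
  have ht : tlog α m x = y ^ p := max_eq_left (Real.one_le_rpow hy1 hp.le)
  rw [ht]
  have hyp : 0 ≤ y ^ p := Real.rpow_nonneg (by linarith) _
  refine (hz _ (hb.trans (le_mul_of_one_le_left hyp hA))).trans ?_
  have hAy : A ≤ y ^ p := by
    calc A = (A ^ (1 / p)) ^ p := by
          rw [← Real.rpow_mul (by linarith), one_div, inv_mul_cancel₀ hp.ne', Real.rpow_one]
      _ ≤ y ^ p := Real.rpow_le_rpow (by positivity) hyA hp.le
  calc (A * y ^ p) ^ (1 / (2 * p)) ≤ (y ^ p * y ^ p) ^ (1 / (2 * p)) := by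
        gcongr
    _ = y := by
        rw [← Real.rpow_add (by linarith), ← Real.rpow_mul (by linarith)]
        rw [show (p + p) * (1 / (2 * p)) = 1 by field_simp; ring, Real.rpow_one]

/-- Bernoulli: `1 + (y - 1) ≤ 2 ^ (y - 1)`. Each logarithm thus lowers its argument by at least one,
so iterating reaches `2` and the infimum defining `logStar` is over a nonempty set. -/
theorem logb_two_le_sub_one {y : ℝ} (hy : 2 ≤ y) : Real.logb 2 y ≤ y - 1 := by
  rw [Real.logb_le_iff_le_rpow one_lt_two (by linarith)]
  have := one_add_mul_self_le_rpow_one_add (s := 1) (by norm_num) (p := y - 1) (by linarith)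
  norm_num at this
  exact this

theorem exists_iterate_logb_le {x : ℝ} (hx : 1 ≤ x) :
    ∃ c, 1 ≤ c ∧ (Real.logb 2)^[c] x ≤ 2 := by
  have key : ∀ k : ℕ, ∀ x : ℝ, 1 ≤ x → x ≤ k + 2 → ∃ c, 1 ≤ c ∧ (Real.logb 2)^[c] x ≤ 2 := by
    intro k
    induction k with
    | zero =>
      intro x hx hk
      refine ⟨1, le_rfl, ?_⟩
      rw [Function.iterate_one, Real.logb_le_iff_le_rpow one_lt_two (by linarith)]
      norm_num at hk ⊢
      linarith
    | succ k ih =>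
      intro x hx hk
      rcases le_total x 2 with h | h
      · exact ih x hx (h.trans (by linarith [(Nat.cast_nonneg k : (0 : ℝ) ≤ k)]))
      · obtain ⟨c, hc, hc'⟩ := ih (Real.logb 2 x)
          (by rw [Real.le_logb_iff_rpow_le one_lt_two (by linarith)]; simpa using h)
          ((logb_two_le_sub_one h).trans (by push_cast at hk; linarith))
        exact ⟨c + 1, by omega, by rwa [Function.iterate_succ_apply]⟩
  exact key ⌈x⌉₊ x hx ((Nat.le_ceil x).trans (by linarith))

theorem logStar_spec {x : ℝ} (hx : 1 ≤ x) :
    1 ≤ logStar x ∧ (Real.logb 2)^[logStar x] x ≤ 2 :=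
  Nat.sInf_mem (s := {c : ℕ | 1 ≤ c ∧ (Real.logb 2)^[c] x ≤ 2}) (exists_iterate_logb_le hx)

/-- A finite family of reals that lie in `[x₀, M]` and drop by at least `g` from each one to the
next smaller one is small, if `g ∘ g` is below the logarithm. -/
theorem exists_le_iterate_logb {ι : Type*} [DecidableEq ι] {g : ℝ → ℝ} {x₀ : ℝ} (hx₀ : 2 < x₀)
    (hg : ∀ x y, x₀ ≤ x → x ≤ y → g x ≤ g y) (hgg : ∀ x, x₀ ≤ x → g (g x) ≤ Real.logb 2 x)
    (x : ι → ℝ) (c : ℕ) : ∀ (J : Finset ι) (M : ℝ), (∀ j ∈ J, x₀ ≤ x j) → (∀ j ∈ J, x j ≤ M) →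
      (∀ j ∈ J, ∀ k ∈ J, j ≠ k → x j ≤ x k → x j ≤ g (x k)) → 2 * c < J.card →
      ∃ j ∈ J, x j ≤ (Real.logb 2)^[c] M := by
  induction c with
  | zero =>
    intro J M _ hM _ hc
    obtain ⟨j, hj⟩ := Finset.card_pos.1 (by omega : 0 < J.card)
    exact ⟨j, hj, hM j hj⟩
  | succ c ih =>
    intro J M h0 hM hJ hc
    -- The two largest members `k`, `k'` are discarded. Everything left is at most `g (g (x k))`,
    -- hence at most `log₂ M`: two members pay for one logarithm.
    obtain ⟨k, hk, hkmax⟩ := J.exists_max_image x (Finset.card_pos.1 (by omega))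
    have hck := Finset.card_erase_of_mem hk
    obtain ⟨k', hk', hkmax'⟩ := (J.erase k).exists_max_image x (Finset.card_pos.1 (by omega))
    have hck' := Finset.card_erase_of_mem hk'
    have hkJ' : k' ∈ J := Finset.mem_of_mem_erase hk'
    have hsub : ∀ j ∈ (J.erase k).erase k', j ∈ J := fun j hj =>
      Finset.mem_of_mem_erase (Finset.mem_of_mem_erase hj)
    have h1 : x k' ≤ g (x k) := hJ k' hkJ' k hk (Finset.ne_of_mem_erase hk') (hkmax k' hkJ')
    have hM' : ∀ j ∈ (J.erase k).erase k', x j ≤ Real.logb 2 M := fun j hj => by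
      have hjk : x j ≤ g (x k') := hJ j (hsub j hj) k' hkJ' (Finset.ne_of_mem_erase hj)
        (hkmax' j (Finset.mem_of_mem_erase hj))
      calc x j ≤ g (x k') := hjk
        _ ≤ g (g (x k)) := hg _ _ (h0 k' hkJ') h1
        _ ≤ Real.logb 2 (x k) := hgg _ (h0 k hk)
        _ ≤ Real.logb 2 M := Real.logb_le_logb_of_le one_lt_two (by linarith [h0 k hk]) (hM k hk)
    obtain ⟨j, hj, hjle⟩ := ih ((J.erase k).erase k') (Real.logb 2 M)
      (fun j hj => h0 j (hsub j hj)) hM'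
      (fun j hj l hl => hJ j (hsub j hj) l (hsub l hl)) (by omega)
    exact ⟨j, hsub j hj, by rwa [Function.iterate_succ_apply]⟩

/-! ### Packing in doubling spaces. -/

/-- Packing: a family of `ρ`-separated points in a ball of radius `R` is bounded. -/
theorem DoublingBound.card_le {X : Type*} [MetricSpace X] {C δ : ℝ} (h : DoublingBound X C δ)
    {ι : Type*} (J : Finset ι) (p : ι → X) (x : X) {ρ R : ℝ} (hρ : 0 < ρ) (hρR : ρ ≤ R)
    (hp : ∀ j ∈ J, dist (p j) x < R) (hsep : ∀ j ∈ J, ∀ k ∈ J, j ≠ k → ρ ≤ dist (p j) (p k)) :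
    (J.card : ℝ) ≤ C * (R / ρ) ^ δ := by
  classical
  have hR : 0 < R := hρ.trans_le hρR
  have hinj : Set.InjOn p J := by
    intro j hj k hk hjk
    by_contra hne
    have := hsep j hj k hk hne
    rw [hjk, dist_self] at this
    linarith
  have := h (ρ / R) (div_pos hρ hR) ((div_le_one hR).2 hρR) R hR x (J.image p)
    (by simpa [Metric.mem_ball] using hp) (by
      intro y hy z hz hyz
      obtain ⟨j, hj, rfl⟩ := Finset.mem_image.1 hy
      obtain ⟨k, hk, rfl⟩ := Finset.mem_image.1 hz
      rw [div_mul_cancel₀ _ hR.ne']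
      exact hsep j hj k hk fun h => hyz (by rw [h]))
  rw [Finset.card_image_of_injOn hinj] at this
  rwa [Real.rpow_neg (by positivity), ← Real.inv_rpow (by positivity), inv_div] at this

theorem DoublingBound.one_le {X : Type*} [MetricSpace X] {C δ : ℝ} (h : DoublingBound X C δ)
    (x : X) : 1 ≤ C := by
  have := h.card_le {()} (fun _ => x) x one_pos le_rfl (by simp) (by simp)
  simpa using this

/-! ### Distances between links; how many longer neighbours a link can have. -/

namespace Links

variable {X : Type*} [MetricSpace X] {n : ℕ}

theorem len_pos (L : Links X n) (i : Fin n) : 0 < L.len i := dist_pos.2 (L.ne i)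

theorem sep_comm (L : Links X n) (i j : Fin n) : L.sep i j = L.sep j i := by
  unfold sep
  rw [min_comm (dist (L.s i) (L.r j)), dist_comm (L.s i) (L.s j), dist_comm (L.r i) (L.r j)]

theorem sep_le_sr (L : Links X n) (i j : Fin n) : L.sep i j ≤ dist (L.s i) (L.r j) :=
  (min_le_left _ _).trans (min_le_left _ _)

theorem sep_le_rs (L : Links X n) (i j : Fin n) : L.sep i j ≤ dist (L.s j) (L.r i) :=
  (min_le_left _ _).trans (min_le_right _ _)

theorem sep_le_ss (L : Links X n) (i j : Fin n) : L.sep i j ≤ dist (L.s i) (L.s j) :=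
  (min_le_right _ _).trans (min_le_left _ _)

theorem sep_le_rr (L : Links X n) (i j : Fin n) : L.sep i j ≤ dist (L.r i) (L.r j) :=
  (min_le_right _ _).trans (min_le_right _ _)

theorem sep_nonneg (L : Links X n) (i j : Fin n) : 0 ≤ L.sep i j :=
  le_min (le_min dist_nonneg dist_nonneg) (le_min dist_nonneg dist_nonneg)

/-- The two endpoints of a link. -/
def ends (L : Links X n) (i : Fin n) (b : Bool) : X := if b then L.s i else L.r i

theorem dist_ends_le (L : Links X n) (i : Fin n) (b c : Bool) :
    dist (L.ends i b) (L.ends i c) ≤ L.len i := by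
  cases b <;> cases c <;> simp [ends, len, dist_comm]

theorem sep_le_ends (L : Links X n) (i j : Fin n) (b c : Bool) :
    L.sep i j ≤ dist (L.ends i b) (L.ends j c) := by
  cases b <;> cases c <;> simp only [ends, if_true, Bool.false_eq_true, if_false]
  · exact L.sep_le_rr i j
  · rw [dist_comm]; exact L.sep_le_rs i j
  · exact L.sep_le_sr i j
  · exact L.sep_le_ss i j

theorem exists_ends_eq_sep (L : Links X n) (i j : Fin n) :
    ∃ b c, dist (L.ends i b) (L.ends j c) = L.sep i j := by
  unfold sep
  rcases min_choice (min (dist (L.s i) (L.r j)) (dist (L.s j) (L.r i)))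
    (min (dist (L.s i) (L.s j)) (dist (L.r i) (L.r j))) with h | h
  · rcases min_choice (dist (L.s i) (L.r j)) (dist (L.s j) (L.r i)) with h' | h'
    · exact ⟨true, false, by rw [h, h']; simp [ends]⟩
    · exact ⟨false, true, by rw [h, h']; simp [ends, dist_comm]⟩
  · rcases min_choice (dist (L.s i) (L.s j)) (dist (L.r i) (L.r j)) with h' | h'
    · exact ⟨true, true, by rw [h, h']; simp [ends]⟩
    · exact ⟨false, false, by rw [h, h']; simp [ends]⟩

/-- The endpoint of `i` nearest to `j` need not be the one nearest to `k`; crossing from one to the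
other costs `L.len i`. -/
theorem sep_le_add (L : Links X n) (i j k : Fin n) :
    L.sep j k ≤ L.sep i j + L.len i + L.sep i k := by
  obtain ⟨b, c, h⟩ := L.exists_ends_eq_sep i j
  obtain ⟨b', c', h'⟩ := L.exists_ends_eq_sep i k
  calc L.sep j k ≤ dist (L.ends j c) (L.ends k c') := L.sep_le_ends j k c c'
    _ ≤ dist (L.ends j c) (L.ends i b) + dist (L.ends i b) (L.ends i b')
        + dist (L.ends i b') (L.ends k c') := dist_triangle4 _ _ _ _
    _ ≤ _ := by rw [dist_comm (L.ends j c), h, h']; gcongr; exact L.dist_ends_le i b b'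

theorem indep_iff (L : Links X n) (f : ℝ → ℝ) {i j : Fin n} (h : L.len i ≤ L.len j) :
    L.Indep f i j ↔ L.len i * f (L.len j / L.len i) < L.sep i j := by
  unfold Indep
  rw [max_eq_right h, min_eq_left h, lt_div_iff₀ (L.len_pos i), mul_comm]

theorem indep_comm (L : Links X n) (f : ℝ → ℝ) (i j : Fin n) :
    L.Indep f i j ↔ L.Indep f j i := by
  unfold Indep
  rw [max_comm, min_comm (L.len i), L.sep_comm]

theorem one_le_ratio (L : Links X n) (i : Fin n) : 1 ≤ L.ratio :=
  (div_self (L.len_pos i).ne').symm.le.trans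
    (le_ciSup (f := fun p : Fin n × Fin n => L.len p.1 / L.len p.2)
      (Set.finite_range _).bddAbove (i, i))

theorem div_le_ratio (L : Links X n) (i j : Fin n) : L.len i / L.len j ≤ L.ratio :=
  le_ciSup (f := fun p : Fin n × Fin n => L.len p.1 / L.len p.2)
    (Set.finite_range _).bddAbove (i, j)

/-- In a feasible set, the links that are longer than a given link and close to it are few. -/
theorem Feasible.card_le {L : Links X n} {α β N : ℝ} {S : Finset (Fin n)}
    (hS : L.Feasible α β N S) (hα : 0 < α) (hβ : 0 < β) (hN : 0 ≤ N) {i : Fin n} (hi : i ∈ S)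
    (J : Finset (Fin n)) (hJS : J ⊆ S.erase i)
    (hJ : ∀ j ∈ J, L.len i ≤ L.len j ∧ L.sep i j ≤ L.len i) :
    (J.card : ℝ) ≤ 4 ^ α / β ^ 2 := by
  obtain ⟨P, hP, hfeas⟩ := hS
  have hli := L.len_pos i
  -- The SINR condition at `j` bounds `P j` below in terms of `P i`. As the two cross distances have
  -- product at most `4 * (L.len i * L.len j)`, each `j` disturbs `i` by a fixed fraction of the
  -- signal at `i`.
  have key : ∀ j ∈ J, β * P i / (4 ^ α * L.len i ^ α) ≤ P j / dist (L.s j) (L.r i) ^ α := by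
    intro j hj
    have hjS := hJS hj
    have hne : i ≠ j := (Finset.ne_of_mem_erase hjS).symm
    have hjS' := Finset.mem_of_mem_erase hjS
    have hd1 : 0 < dist (L.s j) (L.r i) := (hfeas i hi).1 j hjS
    have hd2 : 0 < dist (L.s i) (L.r j) :=
      (hfeas j hjS').1 i (Finset.mem_erase.2 ⟨hne, hi⟩)
    have hlj := L.len_pos j
    obtain ⟨hlen, hsep⟩ := hJ j hj
    -- If a sender–receiver distance realises the closeness, one factor is at most `L.len i` and the
    -- other at most `3 * L.len j`; otherwise they are at most `2 * L.len i` and `2 * L.len j`.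
    have hprod : dist (L.s j) (L.r i) * dist (L.s i) (L.r j) ≤ 4 * (L.len i * L.len j) := by
      have hdi : dist (L.s i) (L.r i) = L.len i := rfl
      have hdj : dist (L.s j) (L.r j) = L.len j := rfl
      unfold sep at hsep
      rcases min_le_iff.1 hsep with h | h <;> rcases min_le_iff.1 h with h | h
      · have : dist (L.s j) (L.r i) ≤ 3 * L.len j := by
          have := dist_triangle4 (L.s j) (L.r j) (L.s i) (L.r i)
          rw [dist_comm (L.r j)] at this
          linarith
        nlinarith [mul_le_mul this h hd2.le (by positivity), mul_pos hli hlj]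
      · have : dist (L.s i) (L.r j) ≤ 3 * L.len j := by
          have := dist_triangle4 (L.s i) (L.r i) (L.s j) (L.r j)
          rw [dist_comm (L.r i)] at this
          linarith
        nlinarith [mul_le_mul h this hd2.le (by positivity), mul_pos hli hlj]
      · have h1 : dist (L.s j) (L.r i) ≤ 2 * L.len i := by
          have := dist_triangle (L.s j) (L.s i) (L.r i)
          rw [dist_comm (L.s j) (L.s i)] at this
          linarith
        have h2 : dist (L.s i) (L.r j) ≤ 2 * L.len j := by
          have := dist_triangle (L.s i) (L.s j) (L.r j)
          linarith
        nlinarith [mul_le_mul h1 h2 hd2.le (by positivity)]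
      · have h1 : dist (L.s i) (L.r j) ≤ 2 * L.len i := by
          have := dist_triangle (L.s i) (L.r i) (L.r j)
          linarith
        have h2 : dist (L.s j) (L.r i) ≤ 2 * L.len j := by
          have := dist_triangle (L.s j) (L.r j) (L.r i)
          rw [dist_comm (L.r j) (L.r i)] at this
          linarith
        nlinarith [mul_le_mul h1 h2 hd1.le (by positivity)]
    have hsinr : β * (P i / dist (L.s i) (L.r j) ^ α) ≤ P j / L.len j ^ α := by
      refine le_trans (mul_le_mul_of_nonneg_left ?_ hβ.le) (hfeas j hjS').2
      have := Finset.single_le_sum (f := fun k => P k / dist (L.s k) (L.r j) ^ α)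
        (fun k _ => div_nonneg (hP k).le (Real.rpow_nonneg dist_nonneg _))
        (Finset.mem_erase.2 ⟨hne, hi⟩ : i ∈ S.erase j)
      linarith
    have hpow : dist (L.s j) (L.r i) ^ α * dist (L.s i) (L.r j) ^ α
        ≤ 4 ^ α * (L.len i ^ α * L.len j ^ α) := by
      rw [← Real.mul_rpow dist_nonneg dist_nonneg, ← Real.mul_rpow hli.le hlj.le,
        ← Real.mul_rpow (by norm_num) (by positivity)]
      exact Real.rpow_le_rpow (by positivity) hprod hα.le
    have p1 : 0 < dist (L.s j) (L.r i) ^ α := Real.rpow_pos_of_pos hd1 _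
    have p2 : 0 < dist (L.s i) (L.r j) ^ α := Real.rpow_pos_of_pos hd2 _
    have p3 : 0 < L.len j ^ α := Real.rpow_pos_of_pos hlj _
    have p4 : 0 < L.len i ^ α := Real.rpow_pos_of_pos hli _
    rw [← mul_div_assoc, div_le_div_iff₀ p2 p3] at hsinr
    rw [div_le_div_iff₀ (by positivity) p1]
    have h4 : (0 : ℝ) < 4 ^ α := by positivity
    have hPi := hP i
    have hPj := hP j
    refine le_of_mul_le_mul_right ?_ (mul_pos p2 p3)
    calc β * P i * dist (L.s j) (L.r i) ^ α * (dist (L.s i) (L.r j) ^ α * L.len j ^ α)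
        = (β * P i * L.len j ^ α) * (dist (L.s j) (L.r i) ^ α * dist (L.s i) (L.r j) ^ α) := by
          ring
      _ ≤ (P j * dist (L.s i) (L.r j) ^ α) * (4 ^ α * (L.len i ^ α * L.len j ^ α)) := by
          gcongr
      _ = _ := by ring
  have hsum : (J.card : ℝ) * (β * P i / (4 ^ α * L.len i ^ α))
      ≤ ∑ j ∈ S.erase i, P j / dist (L.s j) (L.r i) ^ α := by
    rw [← nsmul_eq_mul]
    exact (Finset.card_nsmul_le_sum _ _ _ key).trans
      (Finset.sum_le_sum_of_subset_of_nonneg hJS fun k _ _ =>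
        div_nonneg (hP k).le (Real.rpow_nonneg dist_nonneg _))
  have h2 := (hfeas i hi).2
  have p4 : 0 < L.len i ^ α := Real.rpow_pos_of_pos hli _
  have h4 : (0 : ℝ) < 4 ^ α := by positivity
  have hPi := hP i
  have h3 : β * ((J.card : ℝ) * (β * P i / (4 ^ α * L.len i ^ α))) ≤ P i / L.len i ^ α :=
    (mul_le_mul_of_nonneg_left (hsum.trans (by linarith)) hβ.le).trans h2
  rw [le_div_iff₀ (by positivity)]
  refine le_of_mul_le_mul_right ?_ (div_pos hPi (mul_pos h4 p4))
  calc (J.card : ℝ) * β ^ 2 * (P i / (4 ^ α * L.len i ^ α))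
      = β * ((J.card : ℝ) * (β * P i / (4 ^ α * L.len i ^ α))) := by ring
    _ ≤ P i / L.len i ^ α := h3
    _ = _ := by field_simp

/-- Separated links close to `i` and not much shorter than `i` are few. -/
theorem card_le_of_sep_le {C δ : ℝ} (hX : DoublingBound X C δ) (L : Links X n) {i : Fin n} {A : ℝ}
    (hA : 1 ≤ A) (J : Finset (Fin n)) (hlen : ∀ j ∈ J, L.len i ≤ L.len j)
    (hi : ∀ j ∈ J, L.sep i j ≤ A * L.len i)
    (hJ : ∀ j ∈ J, ∀ k ∈ J, j ≠ k → min (L.len j) (L.len k) < L.sep j k) :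
    (J.card : ℝ) ≤ C * (A + 2) ^ δ := by
  have hli := L.len_pos i
  choose b c hbc using L.exists_ends_eq_sep i
  -- The endpoints of the `j` nearest to `i` lie within `(A + 1) * L.len i` of `L.s i`; the radius
  -- `A + 2` makes this strict, as balls are open.
  have := hX.card_le J (fun j => L.ends j (c j)) (L.s i) (ρ := L.len i)
    (R := (A + 2) * L.len i) hli (by nlinarith) (fun j hj => ?_) (fun j hj k hk hjk => ?_)
  · rwa [mul_div_cancel_right₀ _ hli.ne'] at this
  · have h1 := dist_triangle (L.ends j (c j)) (L.ends i (b j)) (L.ends i true)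
    rw [dist_comm (L.ends j (c j)) (L.ends i (b j)), hbc] at h1
    have h2 := L.dist_ends_le i (b j) true
    have h3 := hi j hj
    change dist (L.ends j (c j)) (L.ends i true) < _
    nlinarith
  · exact (le_min (hlen j hj) (hlen k hk)).trans
      ((hJ j hj k hk hjk).le.trans (L.sep_le_ends j k _ _))

/-- Members of `J` with length ratio to `i` at most `x₀` are counted by packing. Beyond `x₀`, two
members close to `i` are close to each other, yet farther apart than the shorter length; so the
smaller ratio is at most a multiple of `tlog` of the larger one, and `exists_le_iterate_logb` limits
the number of such drops. -/
theorem exists_card_longer_le {α m γ C δ : ℝ} (hm : m < α) (hγ : 1 ≤ γ) :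
    ∃ K : ℕ, ∀ (X : Type*) [MetricSpace X], DoublingBound X C δ →
      ∀ (n : ℕ) (L : Links X n) (i : Fin n) (J : Finset (Fin n)),
        (∀ j ∈ J, L.len i ≤ L.len j ∧ ¬ L.Indep (fun x => γ * tlog α m x) i j) →
        (∀ j ∈ J, ∀ k ∈ J, j ≠ k → min (L.len j) (L.len k) < L.sep j k) →
        J.card ≤ K + 2 * logStar L.ratio := by
  -- The bound for `sep j k`, in units of `L.len i`, is two terms `γ * tlog` plus `1`, hence at most
  -- `3 * γ * tlog`.
  obtain ⟨x₀, hx₀, hgg⟩ := exists_mul_tlog_mul_tlog_le (A := 3 * γ) hm (by linarith)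
  refine ⟨⌈C * (γ * tlog α m x₀ + 2) ^ δ⌉₊, fun X _ hX n L i J hJ hsep => ?_⟩
  have hli := L.len_pos i
  have hbound : ∀ j ∈ J, L.sep i j ≤ L.len i * (γ * tlog α m (L.len j / L.len i)) :=
    fun j hj => not_lt.1 fun h => (hJ j hj).2 ((L.indep_iff _ (hJ j hj).1).2 h)
  have hone : ∀ j ∈ J, 1 ≤ L.len j / L.len i := fun j hj => by
    rw [one_le_div hli]; exact (hJ j hj).1
  rw [← Finset.card_filter_add_card_filter_not (fun j => L.len j / L.len i ≤ x₀)]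
  refine add_le_add ?_ ?_
  · rw [← Nat.cast_le (α := ℝ)]
    refine le_trans ?_ (Nat.le_ceil _)
    refine card_le_of_sep_le hX L (i := i)
      (one_le_mul_of_one_le_of_one_le hγ (one_le_tlog α m x₀)) _ ?_ ?_ ?_
    · exact fun j hj => (hJ j (Finset.mem_filter.1 hj).1).1
    · intro j hj
      obtain ⟨hj, hjx⟩ := Finset.mem_filter.1 hj
      rw [mul_comm]
      refine (hbound j hj).trans ?_
      gcongr
      exact tlog_mono hm (hone j hj) hjx
    · exact fun j hj k hk => hsep j (Finset.mem_filter.1 hj).1 k (Finset.mem_filter.1 hk).1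
  · by_contra hcard
    rw [not_le] at hcard
    have hdrop : ∀ j ∈ J.filter fun j => ¬ L.len j / L.len i ≤ x₀,
        ∀ k ∈ J.filter fun j => ¬ L.len j / L.len i ≤ x₀, j ≠ k →
          L.len j / L.len i ≤ L.len k / L.len i →
          L.len j / L.len i ≤ 3 * γ * tlog α m (L.len k / L.len i) := by
      intro j hj k hk hjk hle
      have hj := (Finset.mem_filter.1 hj).1
      have hk := (Finset.mem_filter.1 hk).1
      have hlen : L.len j ≤ L.len k := by
        rwa [div_le_div_iff_of_pos_right hli] at hle
      have h1 := hsep j hj k hk hjk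
      rw [min_eq_left hlen] at h1
      have h2 := L.sep_le_add i j k
      have h3 := hbound j hj
      have h4 := hbound k hk
      have h5 := tlog_mono hm (hone j hj) hle
      have h6 := one_le_tlog α m (L.len k / L.len i)
      have h7 : tlog α m (L.len k / L.len i) ≤ γ * tlog α m (L.len k / L.len i) :=
        le_mul_of_one_le_left (by linarith) hγ
      have h8 : γ * tlog α m (L.len j / L.len i) ≤ γ * tlog α m (L.len k / L.len i) := by
        gcongr
      rw [div_le_iff₀ hli]
      nlinarith
    obtain ⟨j, hj, hjle⟩ := exists_le_iterate_logb (g := fun x => 3 * γ * tlog α m x) hx₀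
      (fun x y hx hxy => by
        have := tlog_mono hm (by linarith) hxy
        gcongr) hgg (fun j => L.len j / L.len i) (logStar L.ratio)
      (J.filter fun j => ¬ L.len j / L.len i ≤ x₀) L.ratio
      (fun j hj => (not_le.1 (Finset.mem_filter.1 hj).2).le) (fun j _ => L.div_le_ratio j i)
      hdrop hcard
    have h2 := (logStar_spec (L.one_le_ratio i)).2
    -- After `logStar L.ratio` logarithms the bound is `2`, below `x₀`, whereas every ratio in the
    -- family exceeds `x₀`.
    exact (Finset.mem_filter.1 hj).2 (by linarith)

/-- Of two independent neighbours both much longer than `i`, the shorter one, of ratio `u`, would be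
separated from the longer one by more than `u * γ * tlog v` (in units of `L.len i`, `v` being their
length ratio), while passing through `i` allows only `O(γ * tlog u * tlog v)`. So at most one
neighbour is much longer, and the others are counted by packing. -/
theorem exists_card_indep_longer_le {α m γ C δ : ℝ} (hm : m < α) (hγ : 1 ≤ γ) :
    ∃ K : ℕ, ∀ (X : Type*) [MetricSpace X], DoublingBound X C δ →
      ∀ (n : ℕ) (L : Links X n) (i : Fin n) (J : Finset (Fin n)),
        (∀ j ∈ J, L.len i ≤ L.len j ∧ ¬ L.Indep (fun x => γ * tlog α m x) i j) →
        (∀ j ∈ J, ∀ k ∈ J, j ≠ k → L.Indep (fun x => γ * tlog α m x) j k) →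
        J.card ≤ K := by
  set p := 2 / (α - m)
  -- The path through `i` costs `γ * tlog u + 1 + γ * tlog (u * v)`, at most `2 + 2 ^ p` times `γ *
  -- tlog u * tlog v`; the constant `3 + 2 ^ p` exceeds this.
  obtain ⟨x₁, hx₁, hx⟩ := exists_mul_tlog_le_rpow α m (3 + 2 ^ p) one_pos
  refine ⟨⌈C * (γ * tlog α m x₁ + 2) ^ δ⌉₊ + 1, fun X _ hX n L i J hJ hind => ?_⟩
  have hli := L.len_pos i
  have hbound : ∀ j ∈ J, L.sep i j ≤ L.len i * (γ * tlog α m (L.len j / L.len i)) :=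
    fun j hj => not_lt.1 fun h => (hJ j hj).2 ((L.indep_iff _ (hJ j hj).1).2 h)
  have hone : ∀ j ∈ J, 1 ≤ L.len j / L.len i := fun j hj => by
    rw [one_le_div hli]; exact (hJ j hj).1
  have hsep : ∀ j ∈ J, ∀ k ∈ J, j ≠ k → min (L.len j) (L.len k) < L.sep j k := by
    intro j hj k hk hjk
    have h := hind j hj k hk hjk
    have hpos : 0 < min (L.len j) (L.len k) := lt_min (L.len_pos j) (L.len_pos k)
    rw [Indep, lt_div_iff₀ hpos] at h
    refine lt_of_le_of_lt (le_mul_of_one_le_left hpos.le ?_) h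
    exact one_le_mul_of_one_le_of_one_le hγ (one_le_tlog _ _ _)
  rw [← Finset.card_filter_add_card_filter_not (fun j => L.len j / L.len i ≤ x₁)]
  refine add_le_add ?_ ?_
  · rw [← Nat.cast_le (α := ℝ)]
    refine le_trans ?_ (Nat.le_ceil _)
    refine card_le_of_sep_le hX L (i := i)
      (one_le_mul_of_one_le_of_one_le hγ (one_le_tlog α m x₁)) _ ?_ ?_ ?_
    · exact fun j hj => (hJ j (Finset.mem_filter.1 hj).1).1
    · intro j hj
      obtain ⟨hj, hjx⟩ := Finset.mem_filter.1 hj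
      rw [mul_comm]
      refine (hbound j hj).trans ?_
      gcongr
      exact tlog_mono hm (hone j hj) hjx
    · exact fun j hj k hk => hsep j (Finset.mem_filter.1 hj).1 k (Finset.mem_filter.1 hk).1
  · have main : ∀ j ∈ J, ∀ k ∈ J, j ≠ k → L.len j ≤ L.len k → L.len j / L.len i < x₁ := by
      intro j hj k hk hjk hlen
      by_contra! hxj
      have hlj := L.len_pos j
      have h1 := (L.indep_iff _ hlen).1 (hind j hj k hk hjk)
      have h2 := L.sep_le_add i j k
      have h3 := hbound j hj
      have h4 := hbound k hk
      set u := L.len j / L.len i with hu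
      set v := L.len k / L.len j with hv
      have hv1 : 1 ≤ v := (one_le_div hlj).2 hlen
      have huv : L.len k / L.len i = u * v := by
        rw [hu, hv]; field_simp
      have hju : L.len j = u * L.len i := by rw [hu]; field_simp
      rw [huv] at h4
      have h5 := tlog_mul_le hm (hone j hj) hv1
      have hu1 := one_le_tlog α m u
      have hv2 := one_le_tlog α m v
      have h6 := hx u hxj
      rw [Real.rpow_one] at h6
      have h2p : (0 : ℝ) < 2 ^ p := by positivity
      have h7 : u * (γ * tlog α m v) < γ * tlog α m u + 1 + γ * tlog α m (u * v) := by
        rw [hju] at h1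
        refine lt_of_mul_lt_mul_left ?_ hli.le
        nlinarith
      have h8 : tlog α m u ≤ tlog α m u * tlog α m v := le_mul_of_one_le_right (by linarith) hv2
      have h9 : 1 ≤ γ * (tlog α m u * tlog α m v) :=
        one_le_mul_of_one_le_of_one_le hγ (one_le_mul_of_one_le_of_one_le hu1 hv2)
      have h10 : (3 + 2 ^ p) * tlog α m u * (γ * tlog α m v) ≤ u * (γ * tlog α m v) := by
        gcongr
      have h11 : γ * tlog α m (u * v) ≤ γ * (2 ^ p * (tlog α m u * tlog α m v)) := by gcongr
      have h12 : γ * tlog α m u ≤ γ * (tlog α m u * tlog α m v) := by gcongr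
      nlinarith
    rw [Finset.card_le_one]
    intro j hj k hk
    obtain ⟨hj, hjx⟩ := Finset.mem_filter.1 hj
    obtain ⟨hk, hkx⟩ := Finset.mem_filter.1 hk
    by_contra hne
    rcases le_total (L.len j) (L.len k) with h | h
    · exact hjx (main j hj k hk hne h).le
    · exact hkx (main k hk j hj (Ne.symm hne) h).le

end Links

/-! ### Splitting feasible sets into independent sets. -/

/-- Greedy colouring: if every vertex has at most `D` neighbours of larger or equal key, then
`D + 1` colours suffice. -/
theorem exists_coloring_of_card_le {ι : Type*} [DecidableEq ι] (adj : ι → ι → Prop)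
    (hadj : ∀ i j, adj i j → adj j i) (key : ι → ℝ) (D : ℕ) (S : Finset ι)
    (h : ∀ i ∈ S, ∀ J ⊆ S.erase i, (∀ j ∈ J, key i ≤ key j ∧ adj i j) → J.card ≤ D) :
    ∃ c : ι → Fin (D + 1), ∀ i ∈ S, ∀ j ∈ S, i ≠ j → adj i j → c i ≠ c j := by
  classical
  induction hk : S.card generalizing S with
  | zero =>
    rw [Finset.card_eq_zero] at hk
    exact ⟨fun _ => 0, by simp [hk]⟩
  | succ k ih =>
    -- The vertex of least key is coloured last, when all its neighbours in `S` count towards `D`.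
    obtain ⟨v, hv, hmin⟩ := S.exists_min_image key (Finset.card_pos.1 (by omega))
    obtain ⟨c, hc⟩ := ih (S.erase v) (fun i hi J hJ hJ' => h i (Finset.mem_of_mem_erase hi) J
      (hJ.trans (Finset.erase_subset_erase _ (Finset.erase_subset _ _))) hJ')
      (by rw [Finset.card_erase_of_mem hv]; omega)
    have hcard := h v hv ((S.erase v).filter (adj v)) (Finset.filter_subset _ _) (fun j hj => by
      obtain ⟨hj, hj'⟩ := Finset.mem_filter.1 hj
      exact ⟨hmin j (Finset.mem_of_mem_erase hj), hj'⟩)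
    obtain ⟨a, ha⟩ : ∃ a : Fin (D + 1), a ∉ ((S.erase v).filter (adj v)).image c := by
      by_contra! hall
      have : (Finset.univ : Finset (Fin (D + 1))) ⊆ ((S.erase v).filter (adj v)).image c :=
        fun a _ => hall a
      have := (Finset.card_le_card this).trans Finset.card_image_le
      rw [Finset.card_univ, Fintype.card_fin] at this
      omega
    have hav : ∀ j ∈ S, j ≠ v → adj v j → c j ≠ a := fun j hj hjv hvj hja =>
      ha (Finset.mem_image.2 ⟨j, Finset.mem_filter.2 ⟨Finset.mem_erase.2 ⟨hjv, hj⟩, hvj⟩, hja⟩)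
    refine ⟨Function.update c v a, fun i hi j hj hij hadj' => ?_⟩
    by_cases hiv : i = v
    · subst hiv
      rw [Function.update_self, Function.update_of_ne (Ne.symm hij)]
      exact (hav j hj (Ne.symm hij) hadj').symm
    · rw [Function.update_of_ne hiv]
      by_cases hjv : j = v
      · subst hjv
        rw [Function.update_self]
        exact hav i hi hiv (hadj _ _ hadj')
      · rw [Function.update_of_ne hjv]
        exact hc i (Finset.mem_erase.2 ⟨hiv, hi⟩) j (Finset.mem_erase.2 ⟨hjv, hj⟩) hij hadj'

namespace Links

/-- A feasible set splits into `O(log* Δ)` independent sets of the conflict graph. -/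
theorem exists_coloring_of_feasible {α β m γ C δ : ℝ} (hα : 0 < α) (hβ : 0 < β) (hm : m < α)
    (hγ : 1 ≤ γ) :
    ∃ K : ℕ, ∀ (X : Type*) [MetricSpace X], DoublingBound X C δ → ∀ (N : ℝ), 0 ≤ N →
      ∀ (n : ℕ) (L : Links X n) (S : Finset (Fin n)), L.Feasible α β N S →
        ∃ c : Fin n → Fin (K * logStar L.ratio), ∀ i ∈ S, ∀ j ∈ S, i ≠ j →
          ¬ L.Indep (fun x => γ * tlog α m x) i j → c i ≠ c j := by
  obtain ⟨K₁, hK₁⟩ := exists_card_longer_le (C := C) (δ := δ) hm hγ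
  set D := ⌊(4 : ℝ) ^ α / β ^ 2⌋₊ with hD
  -- Two colourings are combined, with `D + 1` and `K₁ + 2 * logStar + 1` colours; since `logStar`
  -- is at least `1`, the latter is at most `(K₁ + 3) * logStar`.
  refine ⟨(D + 1) * (K₁ + 3), fun X _ hX N hN n L S hS => ?_⟩
  rcases isEmpty_or_nonempty (Fin n) with hn | ⟨⟨i₀⟩⟩
  · exact ⟨fun i => hn.elim i, fun i => hn.elim i⟩
  have hstar := (logStar_spec (L.one_le_ratio i₀)).1
  -- The first colouring separates links at distance at most the shorter length, as
  -- `exists_card_longer_le` requires within each class.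
  obtain ⟨c₁, hc₁⟩ := exists_coloring_of_card_le
    (fun i j => L.sep i j ≤ min (L.len i) (L.len j))
    (fun i j h => by rwa [L.sep_comm, min_comm]) L.len D S (fun i hi J hJ hJ' => by
      rw [hD, Nat.le_floor_iff (by positivity)]
      refine hS.card_le hα hβ hN hi J hJ fun j hj => ⟨(hJ' j hj).1, ?_⟩
      exact (hJ' j hj).2.trans (min_le_left _ _))
  have h2 : ∀ a : Fin (D + 1), ∃ c₂ : Fin n → Fin (K₁ + 2 * logStar L.ratio + 1),
      ∀ i ∈ S.filter (fun i => c₁ i = a), ∀ j ∈ S.filter (fun i => c₁ i = a), i ≠ j →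
        ¬ L.Indep (fun x => γ * tlog α m x) i j → c₂ i ≠ c₂ j := fun a => by
    refine exists_coloring_of_card_le _ (fun i j h => by rwa [L.indep_comm]) L.len _ _ ?_
    intro i hi J hJ hJ'
    refine hK₁ X hX n L i J hJ' fun j hj k hk hjk => ?_
    obtain ⟨hjS, hja⟩ := Finset.mem_filter.1 (Finset.mem_of_mem_erase (hJ hj))
    obtain ⟨hkS, hka⟩ := Finset.mem_filter.1 (Finset.mem_of_mem_erase (hJ hk))
    by_contra! h
    exact hc₁ j hjS k hkS hjk h (hja.trans hka.symm)
  choose c₂ hc₂ using h2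
  have hle : (D + 1) * (K₁ + 2 * logStar L.ratio + 1) ≤ (D + 1) * (K₁ + 3) * logStar L.ratio := by
    rw [mul_assoc]
    exact Nat.mul_le_mul_left _ (by nlinarith)
  refine ⟨fun i => Fin.castLE hle (finProdFinEquiv (c₁ i, c₂ (c₁ i) i)), ?_⟩
  intro i hi j hj hij hadj heq
  have heq := finProdFinEquiv.injective (Fin.castLE_injective hle heq)
  rw [Prod.mk.injEq] at heq
  obtain ⟨h1, h2⟩ := heq
  rw [← h1] at h2
  exact hc₂ (c₁ i) i (by simp [hi]) j (by simp [hj, h1]) hij hadj h2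

end Links

/-! ### Interference from shorter independent links. -/

/-- The sum over `q.2` is geometric. Since `tlog (2 ^ t) ≥ t ^ (2 / (α - m))`, the sum over `q.1` is
dominated by powers of exponent `2 * (δ - α) / (α - m)`, which is below `-1` exactly when `δ < (α +
m) / 2`. -/
theorem summable_tlog_rpow {α m δ : ℝ} (hm : m < α) (hδ : δ < (α + m) / 2) :
    Summable fun q : ℕ × ℕ => ((2 : ℝ) ^ q.2) ^ (δ - α) * tlog α m (2 ^ q.1) ^ (δ - α) := by
  have h1 : Summable fun k : ℕ => ((2 : ℝ) ^ k) ^ (δ - α) := by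
    have : (fun k : ℕ => ((2 : ℝ) ^ k) ^ (δ - α)) = fun k : ℕ => ((2 : ℝ) ^ (δ - α)) ^ k := by
      funext k
      rw [← Real.rpow_natCast, ← Real.rpow_natCast, ← Real.rpow_mul zero_le_two,
        ← Real.rpow_mul zero_le_two, mul_comm]
    rw [this]
    exact summable_geometric_of_lt_one (by positivity)
      (Real.rpow_lt_one_of_one_lt_of_neg one_lt_two (by linarith))
  have h2 : Summable fun t : ℕ => tlog α m (2 ^ t) ^ (δ - α) := by
    -- The term `t = 0` is dropped: comparison with a negative power of `t` needs `t > 0`.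
    rw [← summable_nat_add_iff 1]
    have h3 : Summable fun t : ℕ => (((t + 1 : ℕ) : ℝ)) ^ (2 / (α - m) * (δ - α)) := by
      rw [summable_nat_add_iff 1 (f := fun t : ℕ => (t : ℝ) ^ (2 / (α - m) * (δ - α))),
        Real.summable_nat_rpow, div_mul_eq_mul_div, div_lt_iff₀ (by linarith)]
      linarith
    refine Summable.of_nonneg_of_le (fun t => Real.rpow_nonneg (tlog_pos _ _ _).le _)
      (fun t => ?_) h3
    rw [Real.rpow_mul (by positivity)]
    refine Real.rpow_le_rpow_of_nonpos (by positivity) ?_ (by linarith)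
    refine (le_of_eq ?_).trans (le_max_left _ _)
    rw [← Real.rpow_natCast, Real.logb_rpow (by norm_num) (by norm_num)]
  exact (h2.mul_of_nonneg h1 (fun t => Real.rpow_nonneg (tlog_pos _ _ _).le _)
    (fun k => by positivity)).congr fun q => mul_comm _ _

namespace Links

variable {X : Type*} [MetricSpace X] {n : ℕ}

/-- Links are grouped by the dyadic class `t` of `ℓ / L.len j` and the dyadic class `k` of the
distance to `x`, relative to its least possible value. Packing bounds each group by a power `δ` of
`2 ^ k * tlog (2 ^ t)`, each term is a power `-α` of it, and the groups sum to the series of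
`summable_tlog_rpow`. -/
theorem sum_div_dist_le {α m γ C δ : ℝ} (hα : 0 < α) (hm : m < α) (hγ : 0 < γ)
    (hδ : δ < (α + m) / 2)
    (hX : DoublingBound X C δ) (L : Links X n) (x : X) (b : Fin n → Bool) (ℓ : ℝ)
    (J : Finset (Fin n)) (hlen : ∀ j ∈ J, L.len j ≤ ℓ)
    (hdist : ∀ j ∈ J, L.len j * (γ * tlog α m (ℓ / L.len j)) < dist (L.ends j (b j)) x)
    (hsep : ∀ j ∈ J, ∀ k ∈ J, j ≠ k → γ * min (L.len j) (L.len k) ≤ L.sep j k) :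
    ∑ j ∈ J, (L.len j / dist (L.ends j (b j)) x) ^ α ≤
      C * 2 ^ δ * (2 / γ) ^ α *
        ∑' q : ℕ × ℕ, ((2 : ℝ) ^ q.2) ^ (δ - α) * tlog α m (2 ^ q.1) ^ (δ - α) := by
  classical
  have hC : 0 ≤ C := zero_le_one.trans (hX.one_le x)
  have h1 : ∀ j, ∃ t : ℕ, j ∈ J → 2 ^ t * L.len j ≤ ℓ ∧ ℓ < 2 ^ (t + 1) * L.len j := by
    intro j
    by_cases hj : j ∈ J
    · have hlj := L.len_pos j
      obtain ⟨t, ht, ht'⟩ := exists_nat_pow_near ((one_le_div hlj).2 (hlen j hj)) one_lt_two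
      exact ⟨t, fun _ => ⟨(le_div_iff₀ hlj).1 ht, (div_lt_iff₀ hlj).1 ht'⟩⟩
    · exact ⟨0, fun h => absurd h hj⟩
  choose t ht using h1
  -- A common lower bound for the mutual separation of the links in class `t`; their lengths are at
  -- most `2 * ρ t / γ`.
  set ρ : ℕ → ℝ := fun t => γ * (ℓ / 2 ^ (t + 1)) with hρ
  have hρt : ∀ j ∈ J, ρ (t j) < γ * L.len j := by
    intro j hj
    have := (ht j hj).2
    simp only [hρ]
    gcongr
    rw [div_lt_iff₀ (by positivity)]
    linarith
  have hρpos : ∀ j ∈ J, 0 < ρ (t j) := by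
    intro j hj
    have : 0 < ℓ := (L.len_pos j).trans_le (hlen j hj)
    simp only [hρ]
    positivity
  have hF : ∀ j ∈ J, ρ (t j) * tlog α m (2 ^ t j) ≤ dist (L.ends j (b j)) x := by
    intro j hj
    have hlj := L.len_pos j
    refine le_trans ?_ (hdist j hj).le
    rw [← mul_assoc, mul_comm (L.len j)]
    refine mul_le_mul (hρt j hj).le (tlog_mono hm (one_le_pow₀ one_le_two) ?_)
      (tlog_pos _ _ _).le (by positivity)
    exact (le_div_iff₀ hlj).2 (ht j hj).1
  have h2 : ∀ j, ∃ k : ℕ, j ∈ J → 2 ^ k * (ρ (t j) * tlog α m (2 ^ t j)) ≤ dist (L.ends j (b j)) x ∧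
      dist (L.ends j (b j)) x < 2 ^ (k + 1) * (ρ (t j) * tlog α m (2 ^ t j)) := by
    intro j
    by_cases hj : j ∈ J
    · have hp := mul_pos (hρpos j hj) (tlog_pos α m (2 ^ t j))
      obtain ⟨k, hk, hk'⟩ := exists_nat_pow_near ((one_le_div hp).2 (hF j hj)) one_lt_two
      exact ⟨k, fun _ => ⟨(le_div_iff₀ hp).1 hk, (div_lt_iff₀ hp).1 hk'⟩⟩
    · exact ⟨0, fun h => absurd h hj⟩
  choose k hk using h2
  have hterm : ∀ j ∈ J, (L.len j / dist (L.ends j (b j)) x) ^ α ≤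
      (2 / γ / (2 ^ k j * tlog α m (2 ^ t j))) ^ α := by
    intro j hj
    have hp := mul_pos (hρpos j hj) (tlog_pos α m (2 ^ t j))
    have hF0 := tlog_pos α m (2 ^ t j)
    have hd : 0 < dist (L.ends j (b j)) x := hp.trans_le (hF j hj)
    have hlj := L.len_pos j
    refine Real.rpow_le_rpow (by positivity) ?_ hα.le
    rw [div_le_iff₀ hd]
    have e1 : L.len j ≤ ℓ / 2 ^ t j := by
      rw [le_div_iff₀ (by positivity)]
      linarith [(ht j hj).1]
    calc L.len j ≤ ℓ / 2 ^ t j := e1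
      _ = 2 / γ / (2 ^ k j * tlog α m (2 ^ t j)) *
          (2 ^ k j * (ρ (t j) * tlog α m (2 ^ t j))) := by
          simp only [hρ, pow_succ]
          field_simp
      _ ≤ _ := by
          have := (hk j hj).1
          gcongr
  have hcard : ∀ q : ℕ × ℕ, ((J.filter fun j => (t j, k j) = q).card : ℝ) ≤
      C * (2 ^ (q.2 + 1) * tlog α m (2 ^ q.1)) ^ δ := by
    rintro ⟨t₀, k₀⟩
    rcases (J.filter fun j => (t j, k j) = (t₀, k₀)).eq_empty_or_nonempty with he | ⟨j₀, hj₀⟩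
    · rw [he, Finset.card_empty, Nat.cast_zero]
      have := tlog_pos α m (2 ^ t₀)
      positivity
    · obtain ⟨hj₁, hq⟩ := Finset.mem_filter.1 hj₀
      rw [Prod.mk.injEq] at hq
      obtain ⟨rfl, rfl⟩ := hq
      have hp := hρpos j₀ hj₁
      have hF0 := one_le_tlog α m (2 ^ t j₀)
      have := hX.card_le (J.filter fun j => (t j, k j) = (t j₀, k j₀))
        (fun j => L.ends j (b j)) x (ρ := ρ (t j₀))
        (R := 2 ^ (k j₀ + 1) * (ρ (t j₀) * tlog α m (2 ^ t j₀))) hp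
        (by
          have : (1 : ℝ) ≤ 2 ^ (k j₀ + 1) * tlog α m (2 ^ t j₀) :=
            one_le_mul_of_one_le_of_one_le (one_le_pow₀ one_le_two) hF0
          nlinarith)
        (fun j hj => by
          obtain ⟨hj, hq⟩ := Finset.mem_filter.1 hj
          rw [Prod.mk.injEq] at hq
          rw [← hq.1, ← hq.2]
          exact (hk j hj).2)
        (fun j hj l hl hjl => by
          obtain ⟨hj, hq⟩ := Finset.mem_filter.1 hj
          obtain ⟨hl, hq'⟩ := Finset.mem_filter.1 hl
          rw [Prod.mk.injEq] at hq hq'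
          refine le_trans ?_ ((hsep j hj l hl hjl).trans (L.sep_le_ends j l _ _))
          rw [mul_min_of_nonneg _ _ hγ.le]
          exact le_min (by rw [← hq.1]; exact (hρt j hj).le) (by rw [← hq'.1]; exact (hρt l hl).le))
      refine this.trans (le_of_eq ?_)
      congr 2
      field_simp
  calc ∑ j ∈ J, (L.len j / dist (L.ends j (b j)) x) ^ α
      ≤ ∑ j ∈ J, (2 / γ / (2 ^ k j * tlog α m (2 ^ t j))) ^ α := Finset.sum_le_sum hterm
    _ = ∑ q ∈ J.image fun j => (t j, k j), ∑ j ∈ J.filter fun j => (t j, k j) = q,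
          (2 / γ / (2 ^ k j * tlog α m (2 ^ t j))) ^ α :=
        (Finset.sum_fiberwise_of_maps_to (fun j hj => Finset.mem_image_of_mem _ hj) _).symm
    _ ≤ ∑ q ∈ J.image fun j => (t j, k j), C * 2 ^ δ * (2 / γ) ^ α *
          (((2 : ℝ) ^ q.2) ^ (δ - α) * tlog α m (2 ^ q.1) ^ (δ - α)) := by
        refine Finset.sum_le_sum fun q _ => ?_
        have e1 : ∑ j ∈ J.filter fun j => (t j, k j) = q,
            (2 / γ / (2 ^ k j * tlog α m (2 ^ t j))) ^ α =
            (J.filter fun j => (t j, k j) = q).card *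
              (2 / γ / (2 ^ q.2 * tlog α m (2 ^ q.1))) ^ α := by
          rw [← nsmul_eq_mul]
          refine Finset.sum_eq_card_nsmul fun j hj => ?_
          rw [← (Finset.mem_filter.1 hj).2]
        rw [e1]
        have hF0 := tlog_pos α m (2 ^ q.1)
        refine (mul_le_mul_of_nonneg_right (hcard q) (by positivity)).trans (le_of_eq ?_)
        rw [Real.div_rpow (by positivity) (by positivity), pow_succ,
          mul_comm ((2 : ℝ) ^ q.2) 2, mul_assoc,
          Real.mul_rpow (by positivity) (by positivity),
          Real.rpow_sub (by positivity), Real.rpow_sub hF0,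
          Real.mul_rpow (by positivity) hF0.le,
          Real.mul_rpow zero_le_two (by positivity : (0 : ℝ) ≤ 2 ^ q.2)]
        field_simp
    _ = C * 2 ^ δ * (2 / γ) ^ α * ∑ q ∈ J.image fun j => (t j, k j),
          (((2 : ℝ) ^ q.2) ^ (δ - α) * tlog α m (2 ^ q.1) ^ (δ - α)) := by
        rw [Finset.mul_sum]
    _ ≤ _ := by
        refine mul_le_mul_of_nonneg_left ?_ (by positivity)
        refine (summable_tlog_rpow hm hδ).sum_le_tsum _ fun q _ => ?_
        have hF0 := tlog_pos α m (2 ^ q.1)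
        positivity

/-! ### Order by length, power assignment and feasibility. -/

/-- The position of a link in the order by length, ties being broken by the index. -/
noncomputable def rank (L : Links X n) (i : Fin n) : ℕ :=
  (Finset.univ.filter fun j => L.len j < L.len i ∨ L.len j = L.len i ∧ j < i).card

theorem rank_lt_rank_iff (L : Links X n) {i j : Fin n} :
    L.rank i < L.rank j ↔ L.len i < L.len j ∨ L.len i = L.len j ∧ i < j := by
  have key : ∀ i j : Fin n, (L.len i < L.len j ∨ L.len i = L.len j ∧ i < j) →
      L.rank i < L.rank j := by
    intro i j h
    refine Finset.card_lt_card (Finset.ssubset_iff_of_subset (fun k hk => ?_) |>.2 ⟨i, ?_, ?_⟩)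
    · simp only [Finset.mem_filter_univ] at hk ⊢
      rcases h with h | ⟨h, h'⟩ <;> rcases hk with hk | ⟨hk, hk'⟩
      · exact Or.inl (hk.trans h)
      · exact Or.inl (hk ▸ h)
      · exact Or.inl (h ▸ hk)
      · exact Or.inr ⟨hk.trans h, hk'.trans h'⟩
    · simpa using h
    · simp
  refine ⟨fun h => ?_, key i j⟩
  by_contra! hne
  rcases hne.1.lt_or_eq with h1 | h1
  · exact absurd (key j i (Or.inl h1)) h.not_gt
  · rcases (hne.2 h1.symm).lt_or_eq with h2 | h2
    · exact absurd (key j i (Or.inr ⟨h1, h2⟩)) h.not_gt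
    · rw [h2] at h; exact h.ne rfl

theorem rank_injective (L : Links X n) : Function.Injective L.rank := by
  intro i j h
  by_contra hne
  rcases lt_trichotomy (L.len i) (L.len j) with h1 | h1 | h1
  · exact (L.rank_lt_rank_iff.2 (Or.inl h1)).ne h
  · rcases lt_or_gt_of_ne hne with h2 | h2
    · exact (L.rank_lt_rank_iff.2 (Or.inr ⟨h1, h2⟩)).ne h
    · exact (L.rank_lt_rank_iff.2 (Or.inr ⟨h1.symm, h2⟩)).ne' h
  · exact (L.rank_lt_rank_iff.2 (Or.inl h1)).ne' h

theorem len_le_of_rank_lt (L : Links X n) {i j : Fin n} (h : L.rank i < L.rank j) :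
    L.len i ≤ L.len j := by
  rcases L.rank_lt_rank_iff.1 h with h | h
  · exact h.le
  · exact h.1.le

theorem rank_lt (L : Links X n) (i : Fin n) : L.rank i < n := by
  have : L.rank i < (Finset.univ : Finset (Fin n)).card :=
    Finset.card_lt_card (Finset.filter_ssubset.2 ⟨i, Finset.mem_univ _, by simp⟩)
  simpa using this

/-- Powers defined from the longest link of `S` to the shortest: the power of a link is twice what
the interference from the longer links requires. -/
noncomputable def recPower (L : Links X n) (α β N : ℝ) (S : Finset (Fin n)) (i : Fin n) : ℝ :=
  2 * β * L.len i ^ α * (∑ k ∈ (S.filter fun k => L.rank i < L.rank k).attach,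
    recPower L α β N S k / dist (L.s k) (L.r i) ^ α + (N + 1))
termination_by n - L.rank i
decreasing_by
  have h1 := (Finset.mem_filter.1 k.2).2
  have h2 := L.rank_lt k
  omega

theorem recPower_eq (L : Links X n) (α β N : ℝ) (S : Finset (Fin n)) (i : Fin n) :
    L.recPower α β N S i = 2 * β * L.len i ^ α * (∑ k ∈ S.filter fun k => L.rank i < L.rank k,
      L.recPower α β N S k / dist (L.s k) (L.r i) ^ α + (N + 1)) := by
  rw [recPower, Finset.sum_attach (S.filter fun k => L.rank i < L.rank k)
    fun k => L.recPower α β N S k / dist (L.s k) (L.r i) ^ α]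

theorem recPower_pos (L : Links X n) {α β N : ℝ} (hβ : 0 < β) (hN : 0 ≤ N) (S : Finset (Fin n))
    (i : Fin n) : 0 < L.recPower α β N S i := by
  induction h : n - L.rank i using Nat.strong_induction_on generalizing i with
  | _ k ih =>
    rw [recPower_eq]
    have := L.len_pos i
    -- `N + 1` in place of `N` keeps the power positive even when `N = 0` and no link is longer.
    refine mul_pos (by positivity) (add_pos_of_nonneg_of_pos (Finset.sum_nonneg fun k hk => ?_)
      (by linarith))
    have h1 := (Finset.mem_filter.1 hk).2
    have h2 := L.rank_lt k
    exact div_nonneg (ih _ (by omega) k rfl).le (Real.rpow_nonneg dist_nonneg _)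

/-- A set of links in which every link receives little from the shorter ones is feasible. -/
theorem feasible_of_sum_le {L : Links X n} {α β N τ : ℝ} (hα : 0 < α) (hβ : 0 < β) (hN : 0 ≤ N)
    {S : Finset (Fin n)} (hτ : 4 * β * 3 ^ α * τ * (4 + 4 * β) ≤ 1)
    (hsep : ∀ i ∈ S, ∀ j ∈ S, L.rank j < L.rank i → L.len j < L.sep i j)
    (hsum : ∀ i ∈ S, ∑ j ∈ S.filter fun j => L.rank j < L.rank i,
      (L.len j / L.sep i j) ^ α ≤ τ) : L.Feasible α β N S := by
  classical
  set P := L.recPower α β N S with hP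
  have hP0 : ∀ i, 0 < P i := fun i => L.recPower_pos hβ hN S i
  have hsep0 : ∀ i ∈ S, ∀ j ∈ S, i ≠ j → 0 < L.sep i j := by
    intro i hi j hj hij
    rcases lt_or_gt_of_ne (L.rank_injective.ne hij) with h | h
    · rw [L.sep_comm]; exact (L.len_pos i).trans (hsep j hj i hi h)
    · exact (L.len_pos j).trans (hsep i hi j hj h)
  have hd0 : ∀ i ∈ S, ∀ j ∈ S, 0 < dist (L.s j) (L.r i) := by
    intro i hi j hj
    by_cases hij : i = j
    · subst hij; exact L.len_pos i
    · exact (hsep0 i hi j hj hij).trans_le (L.sep_le_rs i j)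
  refine ⟨P, hP0, fun i hi => ⟨fun j hj => hd0 i hi j (Finset.mem_of_mem_erase hj), ?_⟩⟩
  set a : Fin n → Fin n → ℝ := fun k i => (dist (L.s k) (L.r i) ^ α)⁻¹ with ha
  have ha0 : ∀ i ∈ S, ∀ k ∈ S, 0 < a k i := fun i hi k hk =>
    inv_pos.2 (Real.rpow_pos_of_pos (hd0 i hi k hk) _)
  set w : Fin n → Fin n → ℝ := fun j i => (L.len j / L.sep i j) ^ α with hw
  have hw0 : ∀ i j, 0 ≤ w j i := fun i j =>
    Real.rpow_nonneg (div_nonneg (L.len_pos j).le (L.sep_nonneg i j)) _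
  have hPeq : ∀ j, P j = 2 * β * L.len j ^ α *
      (∑ k ∈ S.filter fun k => L.rank j < L.rank k, P k * a k j + (N + 1)) := fun j => by
    rw [hP, recPower_eq]; rfl
  have hlw : ∀ i ∈ S, ∀ j ∈ S, L.rank j < L.rank i →
      L.len j ^ α * a j i ≤ w j i ∧ L.len j ^ α * a i j ≤ w j i := by
    intro i hi j hj h
    have h0 := hsep0 i hi j hj (fun h' => by rw [h'] at h; exact h.ne rfl)
    have hl := L.len_pos j
    simp only [ha, hw, ← div_eq_mul_inv]
    rw [Real.div_rpow hl.le h0.le]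
    constructor
    · have := L.sep_le_rs i j
      gcongr
    · have := L.sep_le_sr i j
      gcongr
  -- The path from `L.s k` to `L.r i` through link `j` has three pieces, the middle one being no
  -- longer than the others. The longer outer piece is thus at least a third of the direct distance,
  -- and the shorter one is paired with `L.len j` to form a weight `w`.
  have hkey : ∀ i ∈ S, ∀ j ∈ S, L.rank j < L.rank i → ∀ k ∈ S, L.rank j < L.rank k →
      L.len j ^ α * a j i * a k j ≤ (w j i + w j k) * (3 ^ α * a k i) := by
    intro i hi j hj hji k hk hjk
    have htri : dist (L.s k) (L.r i) ≤
        dist (L.s k) (L.r j) + L.len j + dist (L.s j) (L.r i) := by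
      have := dist_triangle4 (L.s k) (L.r j) (L.s j) (L.r i)
      rwa [dist_comm (L.r j)] at this
    have hlj : L.len j ≤ dist (L.s j) (L.r i) := (hsep i hi j hj hji).le.trans (L.sep_le_rs i j)
    have hlj' : L.len j ≤ dist (L.s k) (L.r j) := (hsep k hk j hj hjk).le.trans (L.sep_le_sr k j)
    have h3 : (0 : ℝ) < 3 ^ α := by positivity
    have hinv : ∀ u : ℝ, 0 < u → dist (L.s k) (L.r i) ≤ 3 * u → (u ^ α)⁻¹ ≤ 3 ^ α * a k i := by
      intro u hu h
      have hpos := Real.rpow_pos_of_pos (hd0 i hi k hk) α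
      simp only [ha]
      rw [← div_eq_mul_inv, inv_eq_one_div, div_le_div_iff₀ (Real.rpow_pos_of_pos hu _) hpos,
        one_mul, ← Real.mul_rpow (by norm_num) hu.le]
      exact Real.rpow_le_rpow dist_nonneg h hα.le
    have hl0 : 0 < L.len j ^ α := Real.rpow_pos_of_pos (L.len_pos j) _
    have hki := ha0 i hi k hk
    rcases le_total (dist (L.s j) (L.r i)) (dist (L.s k) (L.r j)) with h | h
    · calc L.len j ^ α * a j i * a k j ≤ w j i * (3 ^ α * a k i) :=
            mul_le_mul (hlw i hi j hj hji).1 (hinv _ (hd0 j hj k hk) (by linarith))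
              (ha0 j hj k hk).le (hw0 i j)
        _ ≤ _ := by
            have := hw0 k j
            gcongr
            linarith
    · calc L.len j ^ α * a j i * a k j = L.len j ^ α * a k j * a j i := by ring
        _ ≤ w j k * (3 ^ α * a k i) :=
            mul_le_mul (hlw k hk j hj hjk).2 (hinv _ (hd0 i hi j hj) (by linarith))
              (ha0 i hi j hj).le (hw0 k j)
        _ ≤ _ := by
            have := hw0 i j
            gcongr
            linarith
  set A := ∑ k ∈ S.filter fun k => L.rank i < L.rank k, P k * a k i with hA
  set B := ∑ j ∈ S.filter fun j => L.rank j < L.rank i, P j * a j i with hB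
  have hA0 : 0 ≤ A := Finset.sum_nonneg fun k hk =>
    (mul_pos (hP0 k) (ha0 i hi k (Finset.mem_filter.1 hk).1)).le
  have hsplit : S.erase i = (S.filter fun k => L.rank i < L.rank k) ∪
      (S.filter fun k => L.rank k < L.rank i) := by
    ext k
    simp only [Finset.mem_erase, Finset.mem_union, Finset.mem_filter, ← and_or_left]
    rw [and_comm]
    refine and_congr_right fun _ => ⟨fun h => lt_or_gt_of_ne (L.rank_injective.ne (Ne.symm h)), ?_⟩
    rintro (h | h) rfl <;> exact h.ne rfl
  have hdisj : Disjoint (S.filter fun k => L.rank i < L.rank k)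
      (S.filter fun k => L.rank k < L.rank i) :=
    Finset.disjoint_filter.2 fun k _ h h' => h.not_gt h'
  have htotal : ∑ j ∈ S.erase i, P j * a j i = A + B := by
    rw [hsplit, Finset.sum_union hdisj]
  have hself : P i * a i i = 2 * β * (A + (N + 1)) := by
    have hl0 : 0 < L.len i ^ α := Real.rpow_pos_of_pos (L.len_pos i) _
    have : a i i = (L.len i ^ α)⁻¹ := rfl
    rw [this]
    nth_rewrite 1 [hPeq i]
    rw [← hA]
    field_simp
  -- The recursive formula for `P j` is inserted and the summation order exchanged; for each `k`,
  -- the weights at `i` and at `k` each sum to at most `τ`, whence `2 * τ`.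
  have hB' : B ≤ 2 * β * ((∑ k ∈ S, P k * (3 ^ α * a k i) * (2 * τ)) + τ * (N + 1)) := by
    have e1 : ∀ j ∈ S.filter fun j => L.rank j < L.rank i, P j * a j i ≤
        2 * β * ((∑ k ∈ S.filter fun k => L.rank j < L.rank k,
          P k * (3 ^ α * a k i) * (w j i + w j k)) + w j i * (N + 1)) := by
      intro j hj
      obtain ⟨hj, hji⟩ := Finset.mem_filter.1 hj
      rw [hPeq j]
      have : 2 * β * L.len j ^ α * (∑ k ∈ S.filter fun k => L.rank j < L.rank k, P k * a k j
          + (N + 1)) * a j i = 2 * β * ((∑ k ∈ S.filter fun k => L.rank j < L.rank k,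
          P k * (L.len j ^ α * a j i * a k j)) + L.len j ^ α * a j i * (N + 1)) := by
        have e2 : ∑ k ∈ S.filter fun k => L.rank j < L.rank k,
            P k * (L.len j ^ α * a j i * a k j) = L.len j ^ α * a j i *
            ∑ k ∈ S.filter fun k => L.rank j < L.rank k, P k * a k j := by
          rw [Finset.mul_sum]
          exact Finset.sum_congr rfl fun k _ => by ring
        rw [e2]
        ring
      rw [this]
      refine mul_le_mul_of_nonneg_left (add_le_add (Finset.sum_le_sum fun k hk => ?_) ?_)
        (by positivity)
      · obtain ⟨hk, hjk⟩ := Finset.mem_filter.1 hk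
        have := hkey i hi j hj hji k hk hjk
        have hPk := hP0 k
        calc P k * (L.len j ^ α * a j i * a k j)
            ≤ P k * ((w j i + w j k) * (3 ^ α * a k i)) := by gcongr
          _ = _ := by ring
      · exact mul_le_mul_of_nonneg_right (hlw i hi j hj hji).1 (by linarith)
    refine (Finset.sum_le_sum e1).trans ?_
    rw [← Finset.mul_sum, Finset.sum_add_distrib, ← Finset.sum_mul]
    refine mul_le_mul_of_nonneg_left (add_le_add ?_ ?_) (by positivity)
    · rw [Finset.sum_comm' (t' := S) (s' := fun k => S.filter fun j =>
        L.rank j < L.rank i ∧ L.rank j < L.rank k) (by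
          intro j k; simp only [Finset.mem_filter]; tauto)]
      refine Finset.sum_le_sum fun k hk => ?_
      rw [← Finset.mul_sum]
      have hki := ha0 i hi k hk
      have hPk := hP0 k
      refine mul_le_mul_of_nonneg_left ?_ (by positivity)
      rw [Finset.sum_add_distrib, two_mul]
      refine add_le_add ((Finset.sum_le_sum_of_subset_of_nonneg ?_ fun j _ _ => hw0 i j).trans
        (hsum i hi)) ((Finset.sum_le_sum_of_subset_of_nonneg ?_ fun j _ _ => hw0 k j).trans
        (hsum k hk))
      · intro j hj; simp only [Finset.mem_filter] at hj ⊢; tauto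
      · intro j hj; simp only [Finset.mem_filter] at hj ⊢; tauto
    · exact mul_le_mul_of_nonneg_right (hsum i hi) (by linarith)
  -- The sum over all of `S` includes `k = i`, the received signal of `i` itself, equal to `2 * β *
  -- (A + (N + 1))`. The bound on `B` therefore contains `B` again, with a small coefficient.
  have hall : ∑ k ∈ S, P k * (3 ^ α * a k i) * (2 * τ) =
      2 * τ * 3 ^ α * (2 * β * (A + (N + 1)) + (A + B)) := by
    rw [← htotal, ← hself, Finset.add_sum_erase S (fun k => P k * a k i) hi, Finset.mul_sum]
    exact Finset.sum_congr rfl fun k _ => by ring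
  rw [hall] at hB'
  have hB0 : 0 ≤ B := Finset.sum_nonneg fun k hk =>
    (mul_pos (hP0 k) (ha0 i hi k (Finset.mem_filter.1 hk).1)).le
  have hτ0 : 0 ≤ τ := (Finset.sum_nonneg fun j _ => hw0 i j).trans (hsum i hi)
  set c := 4 * β * 3 ^ α * τ with hc
  have hc0 : 0 ≤ c := by positivity
  have h3 : (1 : ℝ) ≤ 3 ^ α := Real.one_le_rpow (by norm_num) hα.le
  have hcτ : 2 * β * τ ≤ c := by
    have : 0 ≤ β * τ := by positivity
    nlinarith
  have hBc : B ≤ c * (2 * β * (A + (N + 1)) + (A + B)) + c * (N + 1) := by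
    refine hB'.trans ?_
    have : 2 * β * τ * (N + 1) ≤ c * (N + 1) := by gcongr
    rw [hc] at this ⊢
    nlinarith
  have hc4 : c * 4 ≤ 1 := by nlinarith
  have hcβ : c * (2 + 2 * β) ≤ 1 / 2 := by linarith
  -- Absorbing `c * B` leaves the shorter links disturbing no more than the longer ones plus `N +
  -- 1`; the factor `2` in the powers covers this.
  have hfin : B ≤ A + (N + 1) := by
    have e1 : c * (2 + 2 * β) * (A + (N + 1)) ≤ 1 / 2 * (A + (N + 1)) :=
      mul_le_mul_of_nonneg_right hcβ (by linarith)
    nlinarith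
  have e1 : ∑ j ∈ S.erase i, P j / dist (L.s j) (L.r i) ^ α = A + B := by
    rw [← htotal]; rfl
  have e2 : P i / L.len i ^ α = 2 * β * (A + (N + 1)) := by rw [← hself]; rfl
  rw [e1, e2]
  nlinarith

theorem Indep.mul_min_lt {L : Links X n} {α m γ : ℝ} (hγ : 0 ≤ γ) {i j : Fin n}
    (h : L.Indep (fun x => γ * tlog α m x) i j) : γ * min (L.len i) (L.len j) < L.sep i j := by
  have hpos : 0 < min (L.len i) (L.len j) := lt_min (L.len_pos i) (L.len_pos j)
  rw [Indep, lt_div_iff₀ hpos] at h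
  refine lt_of_le_of_lt (mul_le_mul_of_nonneg_right ?_ hpos.le) h
  exact le_mul_of_one_le_right hγ (one_le_tlog _ _ _)

/-- Independent sets of the conflict graph are feasible, for a suitable constant. -/
theorem exists_feasible_of_indep {α β m C δ : ℝ} (hα : 0 < α) (hβ : 0 < β) (hm : m < α)
    (hδ : δ < (α + m) / 2) :
    ∃ γ : ℝ, 1 ≤ γ ∧ ∀ (X : Type*) [MetricSpace X], DoublingBound X C δ → ∀ (N : ℝ), 0 ≤ N →
      ∀ (n : ℕ) (L : Links X n) (S : Finset (Fin n)),
        (∀ i ∈ S, ∀ j ∈ S, i ≠ j → L.Indep (fun x => γ * tlog α m x) i j) →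
        L.Feasible α β N S := by
  set τ : ℝ := 1 / (4 * β * 3 ^ α * (4 + 4 * β)) with hτ
  have h3 : (0 : ℝ) < 3 ^ α := by positivity
  have hτ0 : 0 < τ := by positivity
  set T := ∑' q : ℕ × ℕ, ((2 : ℝ) ^ q.2) ^ (δ - α) * tlog α m (2 ^ q.1) ^ (δ - α)
  -- The factor `2` counts the endpoints of the disturbed link: `sum_div_dist_le` measures distances
  -- to one fixed point, so the shorter links are split by the endpoint they are nearest to.
  have hlim : Filter.Tendsto (fun γ : ℝ => 2 * (C * 2 ^ δ * (2 / γ) ^ α * T)) Filter.atTop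
      (nhds (2 * (C * 2 ^ δ * 0 * T))) := by
    refine Filter.Tendsto.const_mul _ (Filter.Tendsto.mul_const _ (Filter.Tendsto.const_mul _ ?_))
    have h1 : Filter.Tendsto (fun γ : ℝ => 2 / γ) Filter.atTop (nhds 0) :=
      Filter.Tendsto.const_div_atTop Filter.tendsto_id 2
    have := h1.rpow_const (p := α) (Or.inr hα.le)
    rwa [Real.zero_rpow hα.ne'] at this
  rw [mul_zero, zero_mul, mul_zero] at hlim
  obtain ⟨γ, hγτ, hγ⟩ := ((hlim.eventually_lt_const hτ0).and (Filter.eventually_ge_atTop 1)).exists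
  have hγ0 : 0 < γ := by linarith
  refine ⟨γ, hγ, fun X _ hX N hN n L S hS => ?_⟩
  refine feasible_of_sum_le (τ := τ) hα hβ hN (le_of_eq ?_) (fun i hi j hj hji => ?_)
    fun i hi => ?_
  · rw [hτ]; field_simp
  · have h := (hS i hi j hj (fun h => by rw [h] at hji; exact hji.ne rfl)).mul_min_lt hγ0.le
    rw [min_eq_right (L.len_le_of_rank_lt hji)] at h
    have := L.len_pos j
    nlinarith
  · set J := S.filter fun j => L.rank j < L.rank i
    choose b c hbc using L.exists_ends_eq_sep i
    have hb : ∀ y : Bool, ∑ j ∈ J.filter (fun j => b j = y), (L.len j / L.sep i j) ^ α ≤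
        C * 2 ^ δ * (2 / γ) ^ α * T := by
      intro y
      have hmem : ∀ j ∈ J.filter (fun j => b j = y),
          j ∈ S ∧ L.rank j < L.rank i ∧ b j = y := by
        intro j hj
        obtain ⟨hj, hy⟩ := Finset.mem_filter.1 hj
        exact ⟨(Finset.mem_filter.1 hj).1, (Finset.mem_filter.1 hj).2, hy⟩
      have heq : ∀ j ∈ J.filter (fun j => b j = y),
          L.sep i j = dist (L.ends j (c j)) (L.ends i y) := by
        intro j hj
        rw [← hbc, dist_comm, (hmem j hj).2.2]
      rw [Finset.sum_congr rfl fun j hj => by rw [heq j hj]]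
      refine sum_div_dist_le hα hm hγ0 hδ hX L _ c (L.len i) _
        (fun j hj => L.len_le_of_rank_lt (hmem j hj).2.1) (fun j hj => ?_)
        (fun j hj k hk hjk => ?_)
      · obtain ⟨h1, h2, h3⟩ := hmem j hj
        rw [← heq j hj, L.sep_comm]
        refine (L.indep_iff _ (L.len_le_of_rank_lt h2)).1 (hS j h1 i hi ?_)
        rintro rfl
        exact h2.ne rfl
      · exact ((hS j (hmem j hj).1 k (hmem k hk).1 hjk).mul_min_lt hγ0.le).le
    have hsplit : ∑ j ∈ J, (L.len j / L.sep i j) ^ α =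
        ∑ j ∈ J.filter (fun j => b j = true), (L.len j / L.sep i j) ^ α +
        ∑ j ∈ J.filter (fun j => b j = false), (L.len j / L.sep i j) ^ α := by
      rw [← Finset.sum_filter_add_sum_filter_not J (fun j => b j = true)]
      simp
    rw [hsplit]
    linarith [hb true, hb false]

end Links

/-! ### Total correctness and step counts of programs. -/

namespace RealRAM

/-- A bound on the number of steps of a program all of whose loops make at most `n` rounds. -/
def Program.bound (n : ℕ) : Program → ℕ
  | skip => 1
  | setNat _ i e => i.ops + e.ops + 1
  | setReal _ i j e => i.ops + j.ops + e.ops + 1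
  | seq p q => p.bound n + q.bound n
  | cond b p q => b.ops + p.bound n + q.bound n + 1
  | loop b p => n * (b.ops + p.bound n + 1) + b.ops + 1

open Polynomial in
/-- `Program.bound` as a polynomial. -/
noncomputable def Program.boundPoly : Program → ℕ[X]
  | skip => C 1
  | setNat _ i e => C (i.ops + e.ops + 1)
  | setReal _ i j e => C (i.ops + j.ops + e.ops + 1)
  | seq p q => p.boundPoly + q.boundPoly
  | cond b p q => C b.ops + p.boundPoly + q.boundPoly + C 1
  | loop b p => X * (C b.ops + p.boundPoly + C 1) + C b.ops + C 1

theorem Program.eval_boundPoly (n : ℕ) (p : Program) : p.boundPoly.eval n = p.bound n := by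
  induction p with
  | skip | setNat | setReal => simp only [boundPoly, bound, Polynomial.eval_C]
  | seq p q hp hq => simp only [boundPoly, bound, Polynomial.eval_add, hp, hq]
  | cond b p q hp hq =>
    simp only [boundPoly, bound, Polynomial.eval_add, hp, hq, Polynomial.eval_C]
  | loop b p hp =>
    simp only [boundPoly, bound, Polynomial.eval_add, Polynomial.eval_mul, Polynomial.eval_X, hp,
      Polynomial.eval_C]

/-- Program `p`, started in `σ`, halts within `p.bound n` steps in a store satisfying `Q`. -/
def WP (n : ℕ) (p : Program) (σ : Store) (Q : Store → Prop) : Prop :=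
  ∃ τ t, Run p σ τ t ∧ t ≤ p.bound n ∧ Q τ

theorem WP.mono {n : ℕ} {p : Program} {σ : Store} {Q R : Store → Prop} (h : WP n p σ Q)
    (hQR : ∀ τ, Q τ → R τ) : WP n p σ R := by
  obtain ⟨τ, t, hr, ht, hQ⟩ := h
  exact ⟨τ, t, hr, ht, hQR τ hQ⟩

theorem WP.skip {n : ℕ} {σ : Store} {Q : Store → Prop} (h : Q σ) : WP n .skip σ Q :=
  ⟨σ, 1, .skip σ, le_rfl, h⟩

theorem WP.setNat {n a : ℕ} {i e : NExpr} {σ : Store} {Q : Store → Prop}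
    (h : Q (σ.setNat a (i.eval σ) (e.eval σ))) : WP n (.setNat a i e) σ Q :=
  ⟨_, _, .setNat σ a i e, le_rfl, h⟩

theorem WP.setReal {n a : ℕ} {i j : NExpr} {e : RExpr} {σ : Store} {Q : Store → Prop}
    (h : Q (σ.setReal a (i.eval σ) (j.eval σ) (e.eval σ))) : WP n (.setReal a i j e) σ Q :=
  ⟨_, _, .setReal σ a i j e, le_rfl, h⟩

theorem WP.seq {n : ℕ} {p q : Program} {σ : Store} {Q : Store → Prop}
    (h : WP n p σ fun τ => WP n q τ Q) : WP n (.seq p q) σ Q := by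
  obtain ⟨τ, t, hr, ht, ρ, u, hr', hu, hQ⟩ := h
  exact ⟨ρ, t + u, .seq hr hr', add_le_add ht hu, hQ⟩

theorem WP.cond {n : ℕ} {b : Test} {p q : Program} {σ : Store} {Q : Store → Prop}
    (h1 : b.Holds σ → WP n p σ Q) (h2 : ¬ b.Holds σ → WP n q σ Q) : WP n (.cond b p q) σ Q := by
  by_cases hb : b.Holds σ
  · obtain ⟨τ, t, hr, ht, hQ⟩ := h1 hb
    exact ⟨τ, _, .condTrue hb hr, by simp only [Program.bound]; omega, hQ⟩
  · obtain ⟨τ, t, hr, ht, hQ⟩ := h2 hb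
    exact ⟨τ, _, .condFalse hb hr, by simp only [Program.bound]; omega, hQ⟩

/-- The invariant is indexed by the rounds completed, and the loop makes exactly `n` rounds, which
matches the count in `Program.bound`; the induction is on the rounds remaining. -/
theorem WP.loop {n : ℕ} {b : Test} {p : Program} {σ : Store} {Q : Store → Prop}
    (I : ℕ → Store → Prop) (h0 : I 0 σ)
    (hstep : ∀ k < n, ∀ τ, I k τ → b.Holds τ ∧ WP n p τ (I (k + 1)))
    (hend : ∀ τ, I n τ → ¬ b.Holds τ ∧ Q τ) : WP n (.loop b p) σ Q := by
  have key : ∀ d ≤ n, ∀ σ, I (n - d) σ → ∃ τ t, Run (.loop b p) σ τ t ∧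
      t ≤ d * (b.ops + p.bound n + 1) + b.ops + 1 ∧ Q τ := by
    intro d
    induction d with
    | zero =>
      intro _ σ hσ
      obtain ⟨hb, hQ⟩ := hend σ hσ
      exact ⟨σ, _, .loopFalse hb, by omega, hQ⟩
    | succ d ih =>
      intro hd σ hσ
      obtain ⟨hb, τ, t, hr, ht, hI⟩ := hstep (n - (d + 1)) (by omega) σ hσ
      rw [show n - (d + 1) + 1 = n - d by omega] at hI
      obtain ⟨ρ, u, hr', hu, hQ⟩ := ih (by omega) τ hI
      exact ⟨ρ, _, .loopTrue hb hr hr', by rw [add_mul, one_mul]; omega, hQ⟩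
  exact key n le_rfl σ (by rwa [Nat.sub_self])

theorem Store.nat_setNat (σ : Store) (a i v b j : ℕ) :
    (σ.setNat a i v).nat b j = if b = a ∧ j = i then v else σ.nat b j := by
  unfold Store.setNat
  by_cases hb : b = a
  · subst hb
    by_cases hj : j = i
    · subst hj; simp
    · simp [hj]
  · simp [hb]

theorem Store.nat_setNat_of_ne (σ : Store) {a b : ℕ} (i v : ℕ) (h : b ≠ a) :
    (σ.setNat a i v).nat b = σ.nat b := by
  unfold Store.setNat
  simp [h]

@[simp]
theorem Store.real_setNat (σ : Store) (a i v : ℕ) : (σ.setNat a i v).real = σ.real := rfl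

@[simp]
theorem Store.nat_setReal (σ : Store) (a i j : ℕ) (v : ℝ) : (σ.setReal a i j v).nat = σ.nat := rfl

theorem Store.real_setReal (σ : Store) (a i j : ℕ) (v : ℝ) (b k l : ℕ) :
    (σ.setReal a i j v).real b k l = if b = a ∧ k = i ∧ l = j then v else σ.real b k l := by
  unfold Store.setReal
  by_cases hb : b = a
  · subst hb
    by_cases hk : k = i
    · subst hk
      by_cases hl : l = j
      · subst hl; simp
      · simp [hl]
    · simp [hk]
  · simp [hb]

theorem Store.real_setReal_of_ne (σ : Store) {a b : ℕ} (i j : ℕ) (v : ℝ) (h : b ≠ a) :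
    (σ.setReal a i j v).real b = σ.real b := by
  unfold Store.setReal
  simp [h]

/-- Cell `0` of a natural-number array. -/
abbrev NExpr.var (a : ℕ) : NExpr := .get a (.lit 0)

/-- `for c = 0, …, n - 1`, where `n` is in cell `0` of array `0`. -/
def forTo (c : ℕ) (p : Program) : Program :=
  .seq (.setNat c (.lit 0) (.lit 0)) (.loop (.natLt (.var c) (.var 0))
    (.seq p (.setNat c (.lit 0) (.add (.var c) (.lit 1)))))

/-- The body must preserve the counter cell. The invariant is imposed after the counter update, so
at each use it must be seen not to depend on that cell. -/
theorem WP.forTo {n c : ℕ} {p : Program} {σ : Store} {Q : Store → Prop} (I : ℕ → Store → Prop)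
    (hn : ∀ k τ, I k τ → τ.nat 0 0 = n) (h0 : I 0 (σ.setNat c 0 0))
    (hstep : ∀ k < n, ∀ τ, τ.nat c 0 = k → I k τ →
      WP n p τ fun τ' => τ'.nat c 0 = k ∧ I (k + 1) (τ'.setNat c 0 (k + 1)))
    (hend : ∀ τ, I n τ → Q τ) : WP n (forTo c p) σ Q := by
  refine WP.seq (WP.setNat (WP.loop (fun k τ => τ.nat c 0 = k ∧ I k τ) ⟨?_, h0⟩ ?_ ?_))
  · simp [Store.nat_setNat, NExpr.eval]
  · rintro k hk τ ⟨hc, hI⟩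
    refine ⟨?_, WP.seq ((hstep k hk τ hc hI).mono ?_)⟩
    · simp only [Test.Holds, NExpr.eval, hc, hn k τ hI, hk]
    · rintro τ' ⟨hc', hI'⟩
      refine WP.setNat ?_
      simp only [NExpr.eval, hc']
      exact ⟨by simp [Store.nat_setNat], hI'⟩
  · rintro τ ⟨hc, hI⟩
    exact ⟨by simp [Test.Holds, NExpr.eval, hc, hn n τ hI], hend τ hI⟩

end RealRAM

/-! ### Testing independence and length order on the machine. -/

theorem Fin.filter_val_lt_succ {n k : ℕ} (hk : k < n) :
    (Finset.univ.filter fun j : Fin n => j.val < k + 1) =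
      insert ⟨k, hk⟩ (Finset.univ.filter fun j : Fin n => j.val < k) := by
  ext j
  simp only [Finset.mem_filter_univ, Finset.mem_insert, Fin.ext_iff]
  omega

theorem Fin.sum_filter_val_lt_succ {M : Type*} [AddCommMonoid M] {n k : ℕ} (hk : k < n)
    (g : Fin n → M) : ∑ j : Fin n with j.val < k + 1, g j =
      ∑ j : Fin n with j.val < k, g j + g ⟨k, hk⟩ := by
  rw [Fin.filter_val_lt_succ hk, Finset.sum_insert (by simp), add_comm]

namespace Links

open RealRAM

variable {X : Type*} [MetricSpace X] {n : ℕ}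

/-- The store still contains the input. -/
def HasInput (L : Links X n) (w : Fin n → ℝ) (α m γ : ℝ) (σ : Store) : Prop :=
  σ.nat 0 0 = n ∧ ∀ a < 5, σ.real a = (L.input w α m γ).real a

theorem hasInput_input (L : Links X n) (w : Fin n → ℝ) (α m γ : ℝ) :
    L.HasInput w α m γ (L.input w α m γ) := ⟨by simp [input], fun _ _ => rfl⟩

/-- The length of the link in `i`. -/
def lenE (i : NExpr) : RExpr := .get 2 i i

/-- `γ` times the length of the link in `i`. -/
def nearE (i : NExpr) : RExpr := .mul (.get 0 (.lit 0) (.lit 2)) (lenE i)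

/-- `γ` times the length of the link in `i` times the power `2 / (α - m)` of the logarithm of the
ratio of the lengths of the links in `j` and `i`. -/
def farE (i j : NExpr) : RExpr :=
  .mul (nearE i) (.exp (.mul (.div (.lit 2) (.sub (.get 0 (.lit 0) (.lit 0))
    (.get 0 (.lit 0) (.lit 1))))
    (.log (.div (.log (.div (lenE j) (lenE i))) (.log (.lit 2))))))

/-- Test whether a distance exceeds the conflict threshold. -/
def exceedT (i j : NExpr) (d : RExpr) : Test :=
  .and (.realLt (nearE i) d) (.realLt (farE i j) d)

/-- Test whether the links in `i` and `j` are independent, that in `i` being the shorter one. -/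
def indepT (i j : NExpr) : Test :=
  .and (.and (exceedT i j (.get 2 i j)) (exceedT i j (.get 2 j i)))
    (.and (exceedT i j (.get 1 i j)) (exceedT i j (.get 3 i j)))

/-- Test whether the link in `i` precedes the link in `j` in the order of `Links.rank`. -/
def beforeT (i j : NExpr) : Test :=
  .not (.and (.not (.realLt (lenE i) (lenE j)))
    (.not (.and (.not (.realLt (lenE j) (lenE i))) (.natLt i j))))

/-- What `indepT` tests. -/
def TestIndep (L : Links X n) (α m γ : ℝ) (i j : Fin n) : Prop :=
  max (γ * L.len i) (γ * L.len i * Real.exp (2 / (α - m) *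
    Real.log (Real.log (L.len j / L.len i) / Real.log 2))) < L.sep i j

/-- The machine has neither powers nor maxima: the power becomes `exp` of a multiple of `log`, and
the maximum in `tlog` becomes a conjunction of two comparisons. Only pairs with the shorter link
first are tested faithfully, so the programs must make the answer on other pairs irrelevant. -/
theorem testIndep_iff (L : Links X n) {α m γ : ℝ} (hm : m < α) (hγ : 0 ≤ γ) {i j : Fin n}
    (h : L.len i ≤ L.len j) :
    L.TestIndep α m γ i j ↔ L.Indep (fun x => γ * tlog α m x) i j := by
  have hli := L.len_pos i
  rw [indep_iff _ _ h, TestIndep]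
  have hp : 0 < 2 / (α - m) := div_pos two_pos (sub_pos.2 hm)
  have hx : 1 ≤ L.len j / L.len i := (one_le_div hli).2 h
  have : max (Real.exp (2 / (α - m) *
      Real.log (Real.log (L.len j / L.len i) / Real.log 2))) 1 = tlog α m (L.len j / L.len i) := by
    unfold tlog
    have h0 : 0 ≤ Real.logb 2 (L.len j / L.len i) := Real.logb_nonneg one_lt_two hx
    rw [Real.log_div_log]
    -- For equal lengths the test takes the logarithm of `0`, which is `0` by convention; the
    -- exponential is then `1`, and the maximum is still right.
    rcases h0.eq_or_lt with h0 | h0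
    · rw [← h0, Real.log_zero, mul_zero, Real.exp_zero, max_self, Real.zero_rpow hp.ne',
        max_eq_right zero_le_one]
    · rw [Real.rpow_def_of_pos h0, mul_comm]
  rw [← this, mul_max_of_nonneg _ _ hγ, mul_max_of_nonneg _ _ hli.le, max_comm]
  ring_nf

section eval

variable {L : Links X n} {w : Fin n → ℝ} {α m γ : ℝ} {σ : Store} {i j : NExpr} {u v : Fin n}

theorem HasInput.eval_lenE (h : L.HasInput w α m γ σ) (hi : i.eval σ = u) :
    (lenE i).eval σ = L.len u := by
  simp [lenE, RExpr.eval, hi, h.2, input, len]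

theorem HasInput.holds_beforeT (h : L.HasInput w α m γ σ) (hi : i.eval σ = u)
    (hj : j.eval σ = v) : (beforeT i j).Holds σ ↔ L.rank u < L.rank v := by
  simp only [beforeT, Test.Holds, h.eval_lenE hi, h.eval_lenE hj, hi, hj, rank_lt_rank_iff,
    Fin.lt_def]
  constructor
  · intro h
    by_contra! h'
    exact h ⟨not_lt.2 h'.1, fun h2 => (h'.2 (le_antisymm (not_lt.1 h2.1) h'.1)).not_gt h2.2⟩
  · rintro (h | ⟨h, h'⟩) ⟨h1, h2⟩
    · exact h1 h
    · exact h2 ⟨by simp [h], h'⟩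

theorem HasInput.holds_indepT (h : L.HasInput w α m γ σ) (hi : i.eval σ = u)
    (hj : j.eval σ = v) : (indepT i j).Holds σ ↔ L.TestIndep α m γ u v := by
  have h1 : (nearE i).eval σ = γ * L.len u := by
    simp [nearE, RExpr.eval, h.eval_lenE hi, h.2, input, NExpr.eval]
  have h2 : (farE i j).eval σ = γ * L.len u * Real.exp (2 / (α - m) *
      Real.log (Real.log (L.len v / L.len u) / Real.log 2)) := by
    simp [farE, RExpr.eval, h.eval_lenE hi, h.eval_lenE hj, h1, h.2, input, NExpr.eval]
  simp only [indepT, exceedT, Test.Holds, h1, h2, TestIndep, sep, lt_min_iff, max_lt_iff]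
  simp [RExpr.eval, hi, hj, h.2, input]

end eval

end Links

/-! ### Sorting and first-fit colouring. -/

namespace Links

open RealRAM

variable {X : Type*} [MetricSpace X] {n : ℕ} {L : Links X n} {w : Fin n → ℝ} {α m γ : ℝ}

theorem HasInput.congr {σ τ : Store} (h : L.HasInput w α m γ σ) (hn : τ.nat 0 = σ.nat 0)
    (hr : ∀ a < 5, τ.real a = σ.real a) : L.HasInput w α m γ τ :=
  ⟨by rw [hn]; exact h.1, fun a ha => by rw [hr a ha]; exact h.2 a ha⟩

theorem card_rank_lt (L : Links X n) (i : Fin n) :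
    (Finset.univ.filter fun j => L.rank j < L.rank i).card = L.rank i := by
  simp_rw [rank_lt_rank_iff]
  rfl

/-- Write the links in the order of `Links.rank` into array `3`. -/
def sortProg : Program :=
  forTo 4 (.seq (.setNat 2 (.lit 0) (.lit 0)) (.seq
    (forTo 5 (.cond (beforeT (.var 5) (.var 4))
      (.setNat 2 (.lit 0) (.add (.var 2) (.lit 1))) .skip))
    (.setNat 3 (.var 2) (.var 4))))

/-- The inner loop counts the predecessors of a link, which is its rank; as ranks are distinct, no
entry of array `3` is overwritten. -/
theorem wp_sortProg {σ : Store} (h : L.HasInput w α m γ σ) :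
    WP n sortProg σ fun τ => (∀ i, τ.nat 3 (L.rank i) = i) ∧ τ.real = σ.real ∧
      ∀ a, a ∉ Finset.Icc 2 5 → τ.nat a = σ.nat a := by
  have hin : ∀ {τ : Store}, (∀ a, a ∉ Finset.Icc 2 5 → τ.nat a = σ.nat a) → τ.real = σ.real →
      L.HasInput w α m γ τ := fun hn hr =>
    h.congr (hn 0 (by decide)) fun a _ => by rw [hr]
  have hset : ∀ {τ : Store}, (∀ a, a ∉ Finset.Icc 2 5 → τ.nat a = σ.nat a) → ∀ b i v,
      b ∈ Finset.Icc 2 5 → ∀ a, a ∉ Finset.Icc 2 5 → (τ.setNat b i v).nat a = σ.nat a :=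
    fun hn b i v hb a ha => by
      rw [Store.nat_setNat_of_ne _ _ _ (fun h => ha (by rw [h]; exact hb)), hn a ha]
  refine WP.forTo (fun k τ => (∀ i : Fin n, i.val < k → τ.nat 3 (L.rank i) = i) ∧
      τ.real = σ.real ∧ ∀ a, a ∉ Finset.Icc 2 5 → τ.nat a = σ.nat a)
    (fun k τ hI => (hin hI.2.2 hI.2.1).1) ⟨by simp, rfl, hset (fun _ _ => rfl) _ _ _ (by decide)⟩
    ?_ (fun τ hI => ⟨fun i => hI.1 i i.2, hI.2⟩)
  rintro k hk τ hτk ⟨hord, hr, hn⟩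
  refine WP.seq (WP.setNat (WP.seq ?_))
  refine WP.forTo (fun l ρ => ρ.nat 2 0 = ∑ j : Fin n with j.val < l,
      (if L.rank j < L.rank ⟨k, hk⟩ then 1 else 0) ∧ ρ.nat 4 0 = k ∧
      (∀ i : Fin n, i.val < k → ρ.nat 3 (L.rank i) = i) ∧
      ρ.real = σ.real ∧ ∀ a, a ∉ Finset.Icc 2 5 → ρ.nat a = σ.nat a)
    (fun l ρ hI => (hin hI.2.2.2.2 hI.2.2.2.1).1) ?_ ?_ ?_
  · refine ⟨by simp [Store.nat_setNat, NExpr.eval], ?_, ?_, hr,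
      hset (hset hn _ _ _ (by decide)) _ _ _ (by decide)⟩
    · simpa [Store.nat_setNat] using hτk
    · simpa [Store.nat_setNat] using hord
  · rintro l hl ρ hρl ⟨hc, hρk, hord, hr, hn⟩
    have hb := (hin hn hr).holds_beforeT (i := .var 5) (j := .var 4) (u := ⟨l, hl⟩) (v := ⟨k, hk⟩)
      hρl hρk
    refine WP.cond (fun h => WP.setNat ?_) (fun h => WP.skip ?_)
    · rw [hb] at h
      refine ⟨by simpa [Store.nat_setNat] using hρl, ?_, ?_, ?_, hr,
        hset (hset hn _ _ _ (by decide)) _ _ _ (by decide)⟩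
      · rw [Fin.sum_filter_val_lt_succ hl, if_pos h]
        simp [Store.nat_setNat, NExpr.eval, hc]
      · simpa [Store.nat_setNat] using hρk
      · simpa [Store.nat_setNat] using hord
    · rw [hb] at h
      refine ⟨hρl, ?_, ?_, ?_, hr, hset hn _ _ _ (by decide)⟩
      · rw [Fin.sum_filter_val_lt_succ hl, if_neg h]
        simp [Store.nat_setNat, hc]
      · simpa [Store.nat_setNat] using hρk
      · simpa [Store.nat_setNat] using hord
  · rintro ρ ⟨hc, hρk, hord, hr, hn⟩
    have hrank : ρ.nat 2 0 = L.rank ⟨k, hk⟩ := by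
      rw [hc, ← Finset.sum_filter, Finset.filter_filter]
      refine Eq.trans ?_ (L.card_rank_lt ⟨k, hk⟩)
      simp
    refine WP.setNat ⟨by simpa [Store.nat_setNat] using hρk, ?_, hr,
      hset (hset hn _ _ _ (by decide)) _ _ _ (by decide)⟩
    intro i hi
    simp only [Store.nat_setNat, NExpr.eval, hrank, hρk]
    by_cases hik : i = ⟨k, hk⟩
    · simp [hik]
    · have h1 : L.rank i ≠ L.rank ⟨k, hk⟩ := L.rank_injective.ne hik
      have h2 : i.val ≠ k := fun h => hik (Fin.ext h)
      simp [h1, hord i (by omega)]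

/-- First-fit colouring from the longest link to the shortest. The colours are written into
array `1`; array `9` marks with `k + 1` the colours that are forbidden in round `k`. -/
def schedProg : Program :=
  .seq sortProg <| forTo 4 <|
    .seq (.setNat 7 (.lit 0) (.get 3 (.sub (.sub (.var 0) (.lit 1)) (.var 4)))) <|
    .seq (forTo 5 (.cond (indepT (.var 7) (.var 5)) .skip
      (.setNat 9 (.get 1 (.var 5)) (.add (.var 4) (.lit 1))))) <|
    .seq (.setNat 8 (.lit 0) (.lit 1)) <|
    .seq (forTo 5 (.cond (.natEq (.get 9 (.var 8)) (.add (.var 4) (.lit 1)))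
      (.setNat 8 (.lit 0) (.add (.var 8) (.lit 1))) .skip))
    (.setNat 1 (.var 7) (.var 8))

/-- The colour of `i` is the least positive one that is not taken by a longer neighbour. -/
def IsFirstFit (L : Links X n) (f : ℝ → ℝ) (c : Fin n → ℕ) (i : Fin n) : Prop :=
  1 ≤ c i ∧ (∀ j, L.rank i < L.rank j → ¬ L.Indep f i j → c i ≠ c j) ∧
    ∀ b, 1 ≤ b → b < c i → ∃ j, L.rank i < L.rank j ∧ ¬ L.Indep f i j ∧ c j = b

/-- All links are tested, coloured or not. Uncoloured ones hold `0` and can only mark colour `0`,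
which is never tried. Earlier marks are at most `k`, so array `9` need not be cleared. -/
theorem wp_mark {σ : Store} (h : L.HasInput w α m γ σ) {v : Fin n} (hv : σ.nat 7 0 = v)
    (k : ℕ) (hk : σ.nat 4 0 = k) (hmark : ∀ b, σ.nat 9 b ≤ k) :
    WP n (forTo 5 (.cond (indepT (.var 7) (.var 5)) .skip
      (.setNat 9 (.get 1 (.var 5)) (.add (.var 4) (.lit 1))))) σ fun τ =>
      (∀ b, τ.nat 9 b ≤ k + 1) ∧
      (∀ b, τ.nat 9 b = k + 1 ↔ ∃ j : Fin n, ¬ L.TestIndep α m γ v j ∧ σ.nat 1 j = b) ∧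
      τ.real = σ.real ∧ ∀ a, a ≠ 5 → a ≠ 9 → τ.nat a = σ.nat a := by
  refine WP.forTo (fun l τ => (∀ b, τ.nat 9 b ≤ k + 1) ∧
      (∀ b, τ.nat 9 b = k + 1 ↔ ∃ j : Fin n, j.val < l ∧ ¬ L.TestIndep α m γ v j ∧ σ.nat 1 j = b) ∧
      τ.real = σ.real ∧ ∀ a, a ≠ 5 → a ≠ 9 → τ.nat a = σ.nat a) ?_ ?_ ?_ ?_
  · rintro l τ ⟨-, -, -, hn⟩
    rw [hn 0 (by decide) (by decide)]
    exact h.1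
  · refine ⟨fun b => ?_, fun b => ?_, rfl, fun a ha _ => Store.nat_setNat_of_ne _ _ _ ha⟩
    · simpa [Store.nat_setNat] using (hmark b).trans (Nat.le_succ k)
    · have := hmark b
      simp [Store.nat_setNat]
      omega
  · rintro l hl τ hτl ⟨hle, hiff, hr, hn⟩
    have hin : L.HasInput w α m γ τ := h.congr (hn 0 (by decide) (by decide)) fun a _ => by rw [hr]
    have hτv : τ.nat 7 0 = v := by rw [hn 7 (by decide) (by decide), hv]
    have hτk : τ.nat 4 0 = k := by rw [hn 4 (by decide) (by decide), hk]
    have hτ1 : τ.nat 1 = σ.nat 1 := hn 1 (by decide) (by decide)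
    have hb := hin.holds_indepT (i := .var 7) (j := .var 5) (u := v) (v := ⟨l, hl⟩) hτv hτl
    have hsucc : ∀ P : Fin n → Prop, (∃ j : Fin n, j.val < l + 1 ∧ P j) ↔
        (∃ j : Fin n, j.val < l ∧ P j) ∨ P ⟨l, hl⟩ := by
      intro P
      constructor
      · rintro ⟨j, hj, hP⟩
        rcases Nat.lt_succ_iff_lt_or_eq.1 hj with h | h
        · exact Or.inl ⟨j, h, hP⟩
        · exact Or.inr (by rwa [show (⟨l, hl⟩ : Fin n) = j from Fin.ext h.symm])
      · rintro (⟨j, hj, hP⟩ | hP)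
        · exact ⟨j, hj.trans (Nat.lt_succ_self l), hP⟩
        · exact ⟨⟨l, hl⟩, Nat.lt_succ_self l, hP⟩
    refine WP.cond (fun ht => WP.skip ?_) (fun ht => WP.setNat ?_)
    · rw [hb] at ht
      refine ⟨hτl, fun b => ?_, fun b => ?_, hr, fun a h5 h9 => ?_⟩
      · simpa [Store.nat_setNat] using hle b
      · rw [hsucc, ← hiff]
        simp [Store.nat_setNat, ht]
      · rw [Store.nat_setNat_of_ne _ _ _ h5, hn a h5 h9]
    · rw [hb] at ht
      refine ⟨by simpa [Store.nat_setNat] using hτl, fun b => ?_, fun b => ?_, hr,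
        fun a h5 h9 => ?_⟩
      · have := hle b
        simp only [Store.nat_setNat, NExpr.eval, hτk]
        split_ifs <;> omega
      · rw [hsucc, ← hiff]
        simp only [Store.nat_setNat, NExpr.eval, hτk, hτl, hτ1, ht]
        by_cases hbl : b = σ.nat 1 l
        · simp [hbl]
        · simp [hbl, Ne.symm hbl]
      · rw [Store.nat_setNat_of_ne _ _ _ h5, Store.nat_setNat_of_ne _ _ _ h9, hn a h5 h9]
  · rintro τ ⟨h1, h2, h3, h4⟩
    exact ⟨h1, fun b => by simp [h2], h3, h4⟩

/-- The candidate moves on only from a forbidden colour: it is either at a free colour or has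
advanced in every round so far. -/
theorem wp_search {σ : Store} (hn : σ.nat 0 0 = n) (k : ℕ) (hk : σ.nat 4 0 = k)
    (h8 : σ.nat 8 0 = 1) :
    WP n (forTo 5 (.cond (.natEq (.get 9 (.var 8)) (.add (.var 4) (.lit 1)))
      (.setNat 8 (.lit 0) (.add (.var 8) (.lit 1))) .skip)) σ fun τ =>
      (1 ≤ τ.nat 8 0 ∧ (∀ b, 1 ≤ b → b < τ.nat 8 0 → σ.nat 9 b = k + 1) ∧
        (τ.nat 8 0 = n + 1 ∨ σ.nat 9 (τ.nat 8 0) ≠ k + 1)) ∧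
      τ.real = σ.real ∧ ∀ a, a ≠ 5 → a ≠ 8 → τ.nat a = σ.nat a := by
  refine WP.forTo (fun l τ =>
      (1 ≤ τ.nat 8 0 ∧ (∀ b, 1 ≤ b → b < τ.nat 8 0 → σ.nat 9 b = k + 1) ∧
        (τ.nat 8 0 = l + 1 ∨ σ.nat 9 (τ.nat 8 0) ≠ k + 1)) ∧
      τ.real = σ.real ∧ ∀ a, a ≠ 5 → a ≠ 8 → τ.nat a = σ.nat a) ?_ ?_ ?_ ?_
  · rintro l τ ⟨-, -, h⟩
    rw [h 0 (by decide) (by decide), hn]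
  · refine ⟨?_, rfl, fun a ha _ => Store.nat_setNat_of_ne _ _ _ ha⟩
    simp only [Store.nat_setNat, h8]
    simp
    omega
  · rintro l hl τ hτl ⟨⟨h1, hlt, hor⟩, hr, hfr⟩
    have hτk : τ.nat 4 0 = k := by rw [hfr 4 (by decide) (by decide), hk]
    have hτ9 : τ.nat 9 = σ.nat 9 := hfr 9 (by decide) (by decide)
    refine WP.cond (fun ht => WP.setNat ?_) (fun ht => WP.skip ?_)
    · simp only [Test.Holds, NExpr.eval, hτk, hτ9] at ht
      refine ⟨by simpa [Store.nat_setNat] using hτl, ?_, hr, fun a h5 h8 => ?_⟩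
      · have hor' : τ.nat 8 0 = l + 1 := hor.resolve_right (fun h => h ht)
        simp only [Store.nat_setNat, NExpr.eval]
        simp
        refine ⟨fun b hb hb' => ?_, Or.inl hor'⟩
        rcases Nat.lt_or_eq_of_le hb' with h | h
        · exact hlt b hb h
        · rw [h, ht]
      · rw [Store.nat_setNat_of_ne _ _ _ h5, Store.nat_setNat_of_ne _ _ _ h8, hfr a h5 h8]
    · simp only [Test.Holds, NExpr.eval, hτk, hτ9] at ht
      refine ⟨hτl, ?_, hr, fun a h5 h8 => ?_⟩
      · simp only [Store.nat_setNat]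
        simp
        exact ⟨h1, hlt, Or.inr ht⟩
      · rw [Store.nat_setNat_of_ne _ _ _ h5, hfr a h5 h8]
  · exact fun τ h => h

/-- The store holds the input and the links sorted by rank. -/
def HasOrder (L : Links X n) (w : Fin n → ℝ) (α m γ : ℝ) (σ : Store) : Prop :=
  L.HasInput w α m γ σ ∧ ∀ i, σ.nat 3 (L.rank i) = i

theorem HasOrder.congr {σ τ : Store} (h : L.HasOrder w α m γ σ) (hn : τ.nat 0 = σ.nat 0)
    (h3 : τ.nat 3 = σ.nat 3) (hr : ∀ a < 5, τ.real a = σ.real a) : L.HasOrder w α m γ τ :=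
  ⟨h.1.congr hn hr, fun i => by rw [h3]; exact h.2 i⟩

theorem exists_rank_eq (L : Links X n) {k : ℕ} (hk : k < n) : ∃ i, L.rank i = k := by
  have hinj : Function.Injective fun i => (⟨L.rank i, L.rank_lt i⟩ : Fin n) := fun i j h =>
    L.rank_injective (Fin.mk.inj_iff.1 h)
  obtain ⟨i, hi⟩ := (Finite.injective_iff_surjective.1 hinj) ⟨k, hk⟩
  exact ⟨i, Fin.mk.inj_iff.1 hi⟩

theorem wp_schedProg (hm : m < α) (hγ : 0 ≤ γ) :
    WP n schedProg (L.input w α m γ) fun τ =>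
      ∀ i, L.IsFirstFit (fun x => γ * tlog α m x) (τ.output n) i := by
  refine WP.seq ((wp_sortProg (L.hasInput_input w α m γ)).mono ?_)
  rintro σ ⟨hord, hr, hfr⟩
  have hσ : L.HasOrder w α m γ σ :=
    ⟨(L.hasInput_input w α m γ).congr (hfr 0 (by decide)) fun a _ => by rw [hr], hord⟩
  refine WP.forTo (fun k τ => L.HasOrder w α m γ τ ∧ (∀ b, τ.nat 9 b ≤ k) ∧
    (∀ i : Fin n, L.rank i + k < n → τ.nat 1 i = 0) ∧
    ∀ i : Fin n, n ≤ L.rank i + k →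
      L.IsFirstFit (fun x => γ * tlog α m x) (fun i => τ.nat 1 i) i)
    (fun k τ hI => hI.1.1.1) ?_ ?_ ?_
  · refine ⟨hσ.congr (Store.nat_setNat_of_ne _ _ _ (by decide))
      (Store.nat_setNat_of_ne _ _ _ (by decide)) fun _ _ => rfl, fun b => ?_, fun i _ => ?_,
      fun i hi => absurd hi (by have := L.rank_lt i; omega)⟩
    · rw [Store.nat_setNat_of_ne _ _ _ (by decide), hfr 9 (by decide)]
      simp [input]
    · rw [Store.nat_setNat_of_ne _ _ _ (by decide), hfr 1 (by decide)]
      simp [input]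
  · rintro k hk τ hτk ⟨hτ, hmark, hzero, hfit⟩
    obtain ⟨v, hv⟩ := L.exists_rank_eq (k := n - 1 - k) (by omega)
    refine WP.seq (WP.setNat (WP.seq ?_))
    have he : NExpr.eval τ (.get 3 (.sub (.sub (.var 0) (.lit 1)) (.var 4))) = v := by
      simp only [NExpr.eval, hτ.1.1, hτk, ← hv, hτ.2]
    rw [he]
    have hτ' : L.HasOrder w α m γ (τ.setNat 7 0 v) :=
      hτ.congr (Store.nat_setNat_of_ne _ _ _ (by decide))
        (Store.nat_setNat_of_ne _ _ _ (by decide)) fun _ _ => rfl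
    refine (wp_mark hτ'.1 (v := v) (by simp [Store.nat_setNat]) k
      (by simpa [Store.nat_setNat] using hτk) (by simpa [Store.nat_setNat] using hmark)).mono ?_
    rintro ρ ⟨hle, hiff, hρr, hρ⟩
    refine WP.seq (WP.setNat (WP.seq ?_))
    have hρ' : L.HasOrder w α m γ ρ := hτ'.congr (hρ 0 (by decide) (by decide))
      (hρ 3 (by decide) (by decide)) fun _ _ => by rw [hρr]
    have hρ1 : ρ.nat 1 = τ.nat 1 := by
      rw [hρ 1 (by decide) (by decide), Store.nat_setNat_of_ne _ _ _ (by decide)]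
    have hρ4 : ρ.nat 4 0 = k := by
      rw [hρ 4 (by decide) (by decide), Store.nat_setNat_of_ne _ _ _ (by decide), hτk]
    have hρ7 : ρ.nat 7 0 = v := by
      rw [hρ 7 (by decide) (by decide), Store.nat_setNat]
      simp
    refine (wp_search (n := n) ?_ k ?_ ?_).mono ?_
    · simpa [Store.nat_setNat] using hρ'.1.1
    · simpa [Store.nat_setNat] using hρ4
    · simp [Store.nat_setNat, NExpr.eval]
    rintro π ⟨⟨hc1, hclt, hcor⟩, hπr, hπ⟩
    rw [Store.nat_setNat_of_ne _ _ _ (by decide)] at hclt hcor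
    have hπa : ∀ a, a ≠ 5 → a ≠ 8 → π.nat a = ρ.nat a := fun a h5 h8 => by
      rw [hπ a h5 h8, Store.nat_setNat_of_ne _ _ _ h8]
    set c := π.nat 8 0 with hc
    have hiff' : ∀ b, ρ.nat 9 b = k + 1 ↔
        ∃ j : Fin n, ¬ L.TestIndep α m γ v j ∧ τ.nat 1 j = b := by
      intro b
      rw [hiff b, Store.nat_setNat_of_ne _ _ _ (by decide)]
    have hv0 : τ.nat 1 v = 0 := hzero v (by omega)
    -- For positive colours the test only matters on links already coloured, and these are longer
    -- than `v`, where it is faithful.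
    have hnew : ∀ b, 1 ≤ b → (ρ.nat 9 b = k + 1 ↔ ∃ j : Fin n, L.rank v < L.rank j ∧
        ¬ L.Indep (fun x => γ * tlog α m x) v j ∧ τ.nat 1 j = b) := by
      intro b hb
      rw [hiff']
      refine exists_congr fun j => ⟨?_, ?_⟩
      · rintro ⟨h1, h2⟩
        have h3 : L.rank v < L.rank j := by
          by_contra hlt
          have hne : v ≠ j := by rintro rfl; omega
          have := L.rank_injective.ne hne
          have := hzero j (by omega)
          omega
        exact ⟨h3, by rwa [testIndep_iff L hm hγ (L.len_le_of_rank_lt h3)] at h1, h2⟩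
      · rintro ⟨h1, h2, h3⟩
        exact ⟨by rwa [testIndep_iff L hm hγ (L.len_le_of_rank_lt h1)], h3⟩
    have hcn : ρ.nat 9 c ≠ k + 1 := by
      rcases hcor with hcor | hcor
      · exfalso
        -- If colours `1, …, n` were all forbidden, the `n` cells of array `1` would take `n + 1`
        -- values, including the `0` still held by `v`.
        have hsub : Finset.range (n + 1) ⊆ Finset.univ.image fun j : Fin n => τ.nat 1 j := by
          intro b hb
          rw [Finset.mem_range] at hb
          rcases Nat.eq_zero_or_pos b with rfl | hb0
          · exact Finset.mem_image.2 ⟨v, Finset.mem_univ _, hv0⟩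
          · obtain ⟨j, -, -, hj⟩ := (hnew b hb0).1 (hclt b hb0 (by omega))
            exact Finset.mem_image.2 ⟨j, Finset.mem_univ _, hj⟩
        have := (Finset.card_le_card hsub).trans Finset.card_image_le
        simp at this
      · exact hcor
    refine WP.setNat ⟨?_, ?_, ?_, ?_, ?_⟩
    · rw [Store.nat_setNat_of_ne _ _ _ (by decide), hπa 4 (by decide) (by decide), hρ4]
    · refine hρ'.congr ?_ ?_ fun _ _ => ?_
      · rw [Store.nat_setNat_of_ne _ _ _ (by decide), Store.nat_setNat_of_ne _ _ _ (by decide),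
          hπa 0 (by decide) (by decide)]
      · rw [Store.nat_setNat_of_ne _ _ _ (by decide), Store.nat_setNat_of_ne _ _ _ (by decide),
          hπa 3 (by decide) (by decide)]
      · simp [hπr]
    · intro b
      rw [Store.nat_setNat_of_ne _ _ _ (by decide), Store.nat_setNat_of_ne _ _ _ (by decide),
        hπa 9 (by decide) (by decide)]
      exact hle b
    all_goals
      simp only [Store.nat_setNat, show ¬ (1 : ℕ) = 4 by decide, false_and, if_false, NExpr.eval,
        hπa 7 (by decide) (by decide), hρ7, ← hc, hπa 1 (by decide) (by decide), hρ1,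
        true_and]
    · intro i hi
      rw [if_neg (fun h => by rw [Fin.ext h] at hi; omega)]
      exact hzero i (by omega)
    · have hother : ∀ j : Fin n, j ≠ v → (if (j : ℕ) = v then c else τ.nat 1 j) = τ.nat 1 j :=
        fun j hj => if_neg fun h => hj (Fin.ext h)
      intro i hi
      by_cases hiv : i = v
      · subst hiv
        have hj : ∀ j, L.rank i < L.rank j → j ≠ i := by rintro j h rfl; exact h.ne rfl
        simp only [IsFirstFit, if_true]
        refine ⟨hc1, fun j h1 h2 h3 => ?_, fun b hb hb' => ?_⟩
        · rw [hother j (hj j h1)] at h3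
          exact hcn ((hnew c hc1).2 ⟨j, h1, h2, h3.symm⟩)
        · obtain ⟨j, h1, h2, h3⟩ := (hnew b hb).1 (hclt b hb hb')
          exact ⟨j, h1, h2, by rw [hother j (hj j h1)]; exact h3⟩
      · have hne := L.rank_injective.ne hiv
        obtain ⟨h1, h2, h3⟩ := hfit i (by omega)
        have hj : ∀ j, L.rank i < L.rank j → j ≠ v := by rintro j h rfl; omega
        simp only [IsFirstFit, hother i hiv]
        refine ⟨h1, fun j hj1 hj2 => ?_, fun b hb hb' => ?_⟩
        · rw [hother j (hj j hj1)]
          exact h2 j hj1 hj2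
        · obtain ⟨j, hj1, hj2, hj3⟩ := h3 b hb hb'
          exact ⟨j, hj1, hj2, by rw [hother j (hj j hj1)]; exact hj3⟩
  · rintro τ ⟨-, -, -, h⟩ i
    exact h i (by omega)

end Links

/-! ### The local-ratio program. -/

namespace Links

open RealRAM

variable {X : Type*} [MetricSpace X] {n : ℕ} {L : Links X n} {w : Fin n → ℝ} {α m γ : ℝ}

/-- Local ratio, from the shortest link to the longest: the residual weights are written into
array `5`. -/
def residualProg : Program :=
  forTo 4 <|
    .seq (.setNat 7 (.lit 0) (.get 3 (.var 4))) <|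
    .seq (.setReal 6 (.lit 0) (.lit 0) (.get 4 (.var 7) (.lit 0))) <|
    .seq (forTo 5 (.cond (indepT (.var 5) (.var 7)) .skip
      (.setReal 6 (.lit 0) (.lit 0)
        (.sub (.get 6 (.lit 0) (.lit 0)) (.get 5 (.var 5) (.lit 0))))))
    (.cond (.realLt (.lit 0) (.get 6 (.lit 0) (.lit 0)))
      (.setReal 5 (.var 7) (.lit 0) (.get 6 (.lit 0) (.lit 0))) .skip)

/-- From the longest link to the shortest, select the links with positive residual weight that are
independent of those selected before. -/
def selectProg : Program :=
  forTo 4 <|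
    .seq (.setNat 7 (.lit 0) (.get 3 (.sub (.sub (.var 0) (.lit 1)) (.var 4)))) <|
    .seq (.cond (.realLt (.lit 0) (.get 5 (.var 7) (.lit 0))) (.setNat 8 (.lit 0) (.lit 1))
      (.setNat 8 (.lit 0) (.lit 0))) <|
    .seq (forTo 5 (.cond (.and (.natEq (.get 1 (.var 5)) (.lit 1))
      (.not (indepT (.var 7) (.var 5)))) (.setNat 8 (.lit 0) (.lit 0)) .skip))
    (.setNat 1 (.var 7) (.var 8))

/-- The local-ratio algorithm for weighted independent sets. -/
def capProg : Program := .seq sortProg (.seq residualProg selectProg)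

open scoped Classical in
theorem wp_subtract {σ : Store} (h : L.HasInput w α m γ σ) {v : Fin n} (hv : σ.nat 7 0 = v) :
    WP n (forTo 5 (.cond (indepT (.var 5) (.var 7)) .skip
      (.setReal 6 (.lit 0) (.lit 0)
        (.sub (.get 6 (.lit 0) (.lit 0)) (.get 5 (.var 5) (.lit 0)))))) σ fun τ =>
      τ.real 6 0 0 = σ.real 6 0 0 -
        ∑ j : Fin n, (if L.TestIndep α m γ j v then 0 else σ.real 5 j 0) ∧
      (∀ a, a ≠ 6 → τ.real a = σ.real a) ∧ ∀ a, a ≠ 5 → τ.nat a = σ.nat a := by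
  refine WP.forTo (fun l τ => τ.real 6 0 0 = σ.real 6 0 0 -
        ∑ j : Fin n with j.val < l, (if L.TestIndep α m γ j v then 0 else σ.real 5 j 0) ∧
      (∀ a, a ≠ 6 → τ.real a = σ.real a) ∧ ∀ a, a ≠ 5 → τ.nat a = σ.nat a) ?_ ?_ ?_ ?_
  · rintro l τ ⟨-, -, hn⟩
    rw [hn 0 (by decide)]
    exact h.1
  · exact ⟨by simp, fun _ _ => rfl, fun a ha => Store.nat_setNat_of_ne _ _ _ ha⟩
  · rintro l hl τ hτl ⟨hacc, hr, hn⟩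
    have hin : L.HasInput w α m γ τ := h.congr (hn 0 (by decide)) fun a ha => hr a (by omega)
    have hτv : τ.nat 7 0 = v := by rw [hn 7 (by decide), hv]
    have hb := hin.holds_indepT (i := .var 5) (j := .var 7) (u := ⟨l, hl⟩) (v := v) hτl hτv
    refine WP.cond (fun ht => WP.skip ?_) (fun ht => WP.setReal ?_)
    · rw [hb] at ht
      refine ⟨hτl, ?_, hr, fun a ha => ?_⟩
      · rw [Fin.sum_filter_val_lt_succ hl, if_pos ht, add_zero, ← hacc]
        rfl
      · rw [Store.nat_setNat_of_ne _ _ _ ha, hn a ha]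
    · rw [hb] at ht
      refine ⟨hτl, ?_, fun a ha => ?_, fun a ha => ?_⟩
      · rw [Fin.sum_filter_val_lt_succ hl, if_neg ht, ← sub_sub, ← hacc]
        simp [Store.real_setReal, NExpr.eval, RExpr.eval, hτl, hr 5 (by decide)]
      · rw [Store.real_setNat, Store.real_setReal_of_ne _ _ _ _ ha, hr a ha]
      · rw [Store.nat_setNat_of_ne _ _ _ ha, Store.nat_setReal, hn a ha]
  · rintro τ ⟨h1, h2, h3⟩
    exact ⟨by simpa using h1, h2, h3⟩

open scoped Classical in
/-- `b i` is the positive part of the weight of `i` minus the residuals of the shorter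
neighbours. -/
def IsResidual (L : Links X n) (f : ℝ → ℝ) (w b : Fin n → ℝ) (i : Fin n) : Prop :=
  b i = max 0 (w i - ∑ j, if L.rank j < L.rank i ∧ ¬ L.Indep f j i then b j else 0)

theorem wp_residualProg (hm : m < α) (hγ : 0 ≤ γ) {σ : Store} (h : L.HasOrder w α m γ σ)
    (h5 : ∀ i : Fin n, σ.real 5 i 0 = 0) :
    WP n residualProg σ fun τ => L.HasOrder w α m γ τ ∧ τ.nat 1 = σ.nat 1 ∧
      ∀ i, L.IsResidual (fun x => γ * tlog α m x) w (fun i => τ.real 5 i 0) i := by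
  classical
  refine WP.forTo (fun k τ => L.HasOrder w α m γ τ ∧ τ.nat 1 = σ.nat 1 ∧
      (∀ i : Fin n, k ≤ L.rank i → τ.real 5 i 0 = 0) ∧ ∀ i : Fin n, L.rank i < k →
        L.IsResidual (fun x => γ * tlog α m x) w (fun i => τ.real 5 i 0) i)
    (fun k τ hI => hI.1.1.1) ?_ ?_ ?_
  · exact ⟨h.congr (Store.nat_setNat_of_ne _ _ _ (by decide))
      (Store.nat_setNat_of_ne _ _ _ (by decide)) fun _ _ => rfl,
      Store.nat_setNat_of_ne _ _ _ (by decide), fun i _ => h5 i,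
      fun i hi => absurd hi (Nat.not_lt_zero _)⟩
  · rintro k hk τ hτk ⟨hτ, hτ1, hzero, hres⟩
    obtain ⟨v, hv⟩ := L.exists_rank_eq hk
    refine WP.seq (WP.setNat (WP.seq (WP.setReal (WP.seq ?_))))
    have he : NExpr.eval τ (.get 3 (.var 4)) = v := by
      simp only [NExpr.eval, hτk, ← hv, hτ.2]
    rw [he]
    set τ₁ := τ.setNat 7 (NExpr.eval τ (.lit 0)) v with hτ₁
    have hτ₁7 : τ₁.nat 7 0 = v := by simp [hτ₁, Store.nat_setNat, NExpr.eval]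
    have hτ₁n : ∀ a, a ≠ 7 → τ₁.nat a = τ.nat a := fun a ha => Store.nat_setNat_of_ne _ _ _ ha
    have hτ₁o : L.HasOrder w α m γ τ₁ :=
      hτ.congr (hτ₁n 0 (by decide)) (hτ₁n 3 (by decide)) fun _ _ => rfl
    set τ₂ := τ₁.setReal 6 (NExpr.eval τ₁ (.lit 0)) (NExpr.eval τ₁ (.lit 0))
      (RExpr.eval τ₁ (.get 4 (.var 7) (.lit 0))) with hτ₂
    have hτ₂r : ∀ a, a ≠ 6 → τ₂.real a = τ.real a := fun a ha => by
      rw [hτ₂, Store.real_setReal_of_ne _ _ _ _ ha, hτ₁, Store.real_setNat]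
    have hτ₂6 : τ₂.real 6 0 0 = w v := by
      have h4 : τ₁.real 4 = (L.input w α m γ).real 4 := hτ₁o.1.2 4 (by decide)
      simp [hτ₂, Store.real_setReal, NExpr.eval, RExpr.eval, hτ₁7, h4, input]
    have hτ₂o : L.HasOrder w α m γ τ₂ := hτ₁o.congr rfl rfl fun a ha =>
      Store.real_setReal_of_ne _ _ _ _ (by omega)
    refine (wp_subtract hτ₂o.1 (v := v) hτ₁7).mono ?_
    rintro ρ ⟨hacc, hρr, hρn⟩
    rw [hτ₂6, hτ₂r 5 (by decide)] at hacc
    -- Links not yet processed have residual `0`, so whatever the test says about them, only shorter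
    -- neighbours contribute.
    have hsum : ∑ j : Fin n, (if L.TestIndep α m γ j v then 0 else τ.real 5 j 0) =
        ∑ j : Fin n, if L.rank j < L.rank v ∧ ¬ L.Indep (fun x => γ * tlog α m x) j v
          then τ.real 5 j 0 else 0 := by
      refine Finset.sum_congr rfl fun j _ => ?_
      by_cases hj : L.rank j < L.rank v
      · rw [testIndep_iff L hm hγ (L.len_le_of_rank_lt hj)]
        simp [hj]
      · rw [hzero j (by omega)]
        simp
    rw [hsum] at hacc
    have hρo : L.HasOrder w α m γ ρ := hτ₂o.congr (hρn 0 (by decide)) (hρn 3 (by decide))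
      fun a ha => hρr a (by omega)
    have hρ4 : ρ.nat 4 0 = k := by
      rw [hρn 4 (by decide), hτ₂, Store.nat_setReal, hτ₁n 4 (by decide), hτk]
    have hρ7 : ρ.nat 7 0 = v := by rw [hρn 7 (by decide), hτ₂, Store.nat_setReal, hτ₁7]
    have hρ1 : ρ.nat 1 = σ.nat 1 := by
      rw [hρn 1 (by decide), hτ₂, Store.nat_setReal, hτ₁n 1 (by decide), hτ1]
    have hρ5 : ρ.real 5 = τ.real 5 := by rw [hρr 5 (by decide), hτ₂r 5 (by decide)]
    -- Both branches of the final conditional fit this form: if the reduced weight is not positive,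
    -- the cell keeps its initial `0`.
    have key : ∀ π : Store, π.nat = ρ.nat → (∀ a < 5, π.real a = ρ.real a) →
        (∀ j : Fin n, π.real 5 j 0 = if j = v then max 0 (ρ.real 6 0 0) else τ.real 5 j 0) →
        π.nat 4 0 = k ∧ L.HasOrder w α m γ (π.setNat 4 0 (k + 1)) ∧
        (π.setNat 4 0 (k + 1)).nat 1 = σ.nat 1 ∧
        (∀ i : Fin n, k + 1 ≤ L.rank i → (π.setNat 4 0 (k + 1)).real 5 i 0 = 0) ∧
        ∀ i : Fin n, L.rank i < k + 1 → L.IsResidual (fun x => γ * tlog α m x) w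
          (fun i => (π.setNat 4 0 (k + 1)).real 5 i 0) i := by
      intro π hπn hπr hπ5
      refine ⟨by rw [hπn, hρ4], hρo.congr ?_ ?_ hπr, ?_, fun i hi => ?_, fun i hi => ?_⟩
      · rw [Store.nat_setNat_of_ne _ _ _ (by decide), hπn]
      · rw [Store.nat_setNat_of_ne _ _ _ (by decide), hπn]
      · rw [Store.nat_setNat_of_ne _ _ _ (by decide), hπn, hρ1]
      · rw [Store.real_setNat, hπ5, if_neg (by rintro rfl; omega), hzero i (by omega)]
      · simp only [IsResidual, Store.real_setNat, hπ5]
        have hs : ∑ j : Fin n, (if L.rank j < L.rank i ∧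
            ¬ L.Indep (fun x => γ * tlog α m x) j i then
              (if j = v then max 0 (ρ.real 6 0 0) else τ.real 5 j 0) else 0) =
            ∑ j : Fin n, (if L.rank j < L.rank i ∧
            ¬ L.Indep (fun x => γ * tlog α m x) j i then τ.real 5 j 0 else 0) := by
          refine Finset.sum_congr rfl fun j _ => ?_
          split_ifs with h1 h2
          · subst h2; omega
          all_goals rfl
        rw [hs]
        by_cases hiv : i = v
        · subst hiv
          rw [if_pos rfl, hacc]
        · rw [if_neg hiv]
          have := L.rank_injective.ne hiv
          exact hres i (by omega)
    refine WP.cond (fun ht => WP.setReal (key _ rfl (fun a ha => ?_) fun j => ?_))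
      (fun ht => WP.skip (key _ rfl (fun _ _ => rfl) fun j => ?_))
    · exact Store.real_setReal_of_ne _ _ _ _ (by omega)
    · simp only [Test.Holds, RExpr.eval, NExpr.eval, Nat.cast_zero] at ht
      simp only [Store.real_setReal, RExpr.eval, NExpr.eval, hρ7, hρ5, max_eq_right ht.le]
      simp [Fin.ext_iff]
    · simp only [Test.Holds, RExpr.eval, NExpr.eval, Nat.cast_zero, not_lt] at ht
      rw [max_eq_left ht, hρ5]
      split_ifs with hj
      · rw [hj, hzero v hv.ge]
      · rfl
  · rintro τ ⟨h1, h2, -, h4⟩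
    exact ⟨h1, h2, fun i => h4 i (L.rank_lt i)⟩

theorem wp_check {σ : Store} (h : L.HasInput w α m γ σ) {v : Fin n} (hv : σ.nat 7 0 = v)
    (h8 : σ.nat 8 0 ≤ 1) :
    WP n (forTo 5 (.cond (.and (.natEq (.get 1 (.var 5)) (.lit 1))
      (.not (indepT (.var 7) (.var 5)))) (.setNat 8 (.lit 0) (.lit 0)) .skip)) σ fun τ =>
      (τ.nat 8 0 ≤ 1 ∧ (τ.nat 8 0 = 1 ↔ σ.nat 8 0 = 1 ∧
        ∀ j : Fin n, σ.nat 1 j = 1 → L.TestIndep α m γ v j)) ∧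
      τ.real = σ.real ∧ ∀ a, a ≠ 5 → a ≠ 8 → τ.nat a = σ.nat a := by
  refine WP.forTo (fun l τ => (τ.nat 8 0 ≤ 1 ∧ (τ.nat 8 0 = 1 ↔ σ.nat 8 0 = 1 ∧
        ∀ j : Fin n, j.val < l → σ.nat 1 j = 1 → L.TestIndep α m γ v j)) ∧
      τ.real = σ.real ∧ ∀ a, a ≠ 5 → a ≠ 8 → τ.nat a = σ.nat a) ?_ ?_ ?_ ?_
  · rintro l τ ⟨-, -, hn⟩
    rw [hn 0 (by decide) (by decide)]
    exact h.1
  · refine ⟨?_, rfl, fun a ha _ => Store.nat_setNat_of_ne _ _ _ ha⟩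
    simpa [Store.nat_setNat] using h8
  · rintro l hl τ hτl ⟨⟨hle, hiff⟩, hr, hn⟩
    have hin : L.HasInput w α m γ τ := h.congr (hn 0 (by decide) (by decide)) fun a _ => by rw [hr]
    have hτv : τ.nat 7 0 = v := by rw [hn 7 (by decide) (by decide), hv]
    have hτ1 : τ.nat 1 = σ.nat 1 := hn 1 (by decide) (by decide)
    have hb := hin.holds_indepT (i := .var 7) (j := .var 5) (u := v) (v := ⟨l, hl⟩) hτv hτl
    refine WP.cond (fun ht => WP.setNat ?_) (fun ht => WP.skip ?_)
    · simp only [Test.Holds, NExpr.eval, hτl, hτ1] at ht hb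
      rw [hb] at ht
      refine ⟨by simpa [Store.nat_setNat] using hτl, ⟨?_, ?_⟩, hr, fun a h5 h8 => ?_⟩
      · simp [Store.nat_setNat, NExpr.eval]
      · simp only [Store.nat_setNat, NExpr.eval]
        simp
        exact fun _ => ⟨⟨l, hl⟩, le_rfl, ht.1, ht.2⟩
      · rw [Store.nat_setNat_of_ne _ _ _ h5, Store.nat_setNat_of_ne _ _ _ h8, hn a h5 h8]
    · simp only [Test.Holds, NExpr.eval, hτl, hτ1] at ht hb
      rw [hb] at ht
      refine ⟨hτl, ⟨?_, ?_⟩, hr, fun a h5 h8 => ?_⟩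
      · simpa [Store.nat_setNat] using hle
      · have : (τ.setNat 5 0 (l + 1)).nat 8 0 = τ.nat 8 0 := by simp [Store.nat_setNat]
        rw [this, hiff]
        refine and_congr_right fun _ => ⟨fun h j hj hj1 => ?_, fun h j hj => h j (by omega)⟩
        rcases Nat.lt_succ_iff_lt_or_eq.1 hj with hj | hj
        · exact h j hj hj1
        · have hjl : j = ⟨l, hl⟩ := Fin.ext hj
          rw [hjl] at hj1 ⊢
          by_contra hne
          exact ht ⟨hj1, hne⟩
      · rw [Store.nat_setNat_of_ne _ _ _ h5, hn a h5 h8]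
  · rintro τ ⟨⟨h1, h2⟩, h3⟩
    exact ⟨⟨h1, by rw [h2]; simp⟩, h3⟩

/-- `i` is selected iff its residual is positive and it is independent of the longer selected
links. -/
def IsSelected (L : Links X n) (f : ℝ → ℝ) (b : Fin n → ℝ) (o : Fin n → ℕ) (i : Fin n) : Prop :=
  o i = 1 ↔ 0 < b i ∧ ∀ j, L.rank i < L.rank j → o j = 1 → L.Indep f i j

theorem wp_selectProg (hm : m < α) (hγ : 0 ≤ γ) {σ : Store} (h : L.HasOrder w α m γ σ)
    (h1 : ∀ i : Fin n, σ.nat 1 i = 0) :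
    WP n selectProg σ fun τ => ∀ i, L.IsSelected (fun x => γ * tlog α m x)
      (fun i => σ.real 5 i 0) (τ.output n) i := by
  refine WP.forTo (fun k τ => L.HasOrder w α m γ τ ∧ τ.real 5 = σ.real 5 ∧
    (∀ i : Fin n, L.rank i + k < n → τ.nat 1 i = 0) ∧
    ∀ i : Fin n, n ≤ L.rank i + k → L.IsSelected (fun x => γ * tlog α m x)
      (fun i => σ.real 5 i 0) (fun i => τ.nat 1 i) i)
    (fun k τ hI => hI.1.1.1) ?_ ?_ ?_
  · refine ⟨h.congr (Store.nat_setNat_of_ne _ _ _ (by decide))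
      (Store.nat_setNat_of_ne _ _ _ (by decide)) fun _ _ => rfl, rfl, fun i _ => ?_,
      fun i hi => absurd hi (by have := L.rank_lt i; omega)⟩
    rw [Store.nat_setNat_of_ne _ _ _ (by decide), h1 i]
  · rintro k hk τ hτk ⟨hτ, hτ5, hzero, hsel⟩
    obtain ⟨v, hv⟩ := L.exists_rank_eq (k := n - 1 - k) (by omega)
    refine WP.seq (WP.setNat (WP.seq ?_))
    have he : NExpr.eval τ (.get 3 (.sub (.sub (.var 0) (.lit 1)) (.var 4))) = v := by
      simp only [NExpr.eval, hτ.1.1, hτk, ← hv, hτ.2]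
    rw [he]
    set τ₁ := τ.setNat 7 (NExpr.eval τ (.lit 0)) v with hτ₁
    have hτ₁7 : τ₁.nat 7 0 = v := by simp [hτ₁, Store.nat_setNat, NExpr.eval]
    have hτ₁n : ∀ a, a ≠ 7 → τ₁.nat a = τ.nat a := fun a ha => Store.nat_setNat_of_ne _ _ _ ha
    have hflag : WP n (.cond (.realLt (.lit 0) (.get 5 (.var 7) (.lit 0)))
        (.setNat 8 (.lit 0) (.lit 1)) (.setNat 8 (.lit 0) (.lit 0))) τ₁ fun ρ =>
        (ρ.nat 8 0 ≤ 1 ∧ (ρ.nat 8 0 = 1 ↔ 0 < σ.real 5 v 0)) ∧ ρ.nat 7 0 = v ∧ ρ.real = τ.real ∧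
          ∀ a, a ≠ 7 → a ≠ 8 → ρ.nat a = τ.nat a := by
      have hb : (Test.realLt (.lit 0) (.get 5 (.var 7) (.lit 0))).Holds τ₁ ↔
          0 < σ.real 5 v 0 := by
        simp only [Test.Holds, RExpr.eval, NExpr.eval, hτ₁7]
        simp [hτ₁, hτ5]
      refine WP.cond (fun ht => WP.setNat ?_) (fun ht => WP.setNat ?_)
      · rw [hb] at ht
        refine ⟨?_, by simpa [Store.nat_setNat] using hτ₁7, rfl, fun a h7 h8 => ?_⟩
        · simp [Store.nat_setNat, NExpr.eval, ht]
        · rw [Store.nat_setNat_of_ne _ _ _ h8, hτ₁n a h7]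
      · rw [hb] at ht
        refine ⟨?_, by simpa [Store.nat_setNat] using hτ₁7, rfl, fun a h7 h8 => ?_⟩
        · simp [Store.nat_setNat, NExpr.eval, not_lt.1 ht]
        · rw [Store.nat_setNat_of_ne _ _ _ h8, hτ₁n a h7]
    refine hflag.mono ?_
    rintro ρ ⟨⟨hρle, hρiff⟩, hρ7, hρr, hρn⟩
    refine WP.seq ?_
    have hρo : L.HasOrder w α m γ ρ := hτ.congr (hρn 0 (by decide) (by decide))
      (hρn 3 (by decide) (by decide)) fun a _ => by rw [hρr]
    refine (wp_check hρo.1 hρ7 hρle).mono ?_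
    rintro π ⟨⟨hπle, hπiff⟩, hπr, hπn⟩
    have hπ7 : π.nat 7 0 = v := by rw [hπn 7 (by decide) (by decide), hρ7]
    have hπa : ∀ a, a ≠ 5 → a ≠ 7 → a ≠ 8 → π.nat a = τ.nat a := fun a h5 h7 h8 => by
      rw [hπn a h5 h8, hρn a h7 h8]
    set c := π.nat 8 0 with hc
    have hv0 : τ.nat 1 v = 0 := hzero v (by omega)
    -- The program checks against every selected link; at this stage these are all longer than `v`,
    -- since the other output cells are still `0`.
    have hciff : c = 1 ↔ 0 < σ.real 5 v 0 ∧ ∀ j : Fin n, L.rank v < L.rank j → τ.nat 1 j = 1 →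
        L.Indep (fun x => γ * tlog α m x) v j := by
      rw [hπiff, hρiff, hρn 1 (by decide) (by decide)]
      refine and_congr_right fun _ => forall_congr' fun j => ?_
      by_cases hj : L.rank v < L.rank j
      · rw [testIndep_iff L hm hγ (L.len_le_of_rank_lt hj)]
        simp [hj]
      · have : τ.nat 1 j = 0 := by
          by_cases hjv : j = v
          · rw [hjv, hv0]
          · have := L.rank_injective.ne hjv
            exact hzero j (by omega)
        simp [hj, this]
    refine WP.setNat ⟨?_, ?_, ?_, ?_, ?_⟩
    · rw [Store.nat_setNat_of_ne _ _ _ (by decide), hπa 4 (by decide) (by decide) (by decide), hτk]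
    · refine hτ.congr ?_ ?_ fun _ _ => ?_
      · rw [Store.nat_setNat_of_ne _ _ _ (by decide), Store.nat_setNat_of_ne _ _ _ (by decide),
          hπa 0 (by decide) (by decide) (by decide)]
      · rw [Store.nat_setNat_of_ne _ _ _ (by decide), Store.nat_setNat_of_ne _ _ _ (by decide),
          hπa 3 (by decide) (by decide) (by decide)]
      · simp [hπr, hρr]
    · simp [hπr, hρr, hτ5]
    all_goals
      simp only [Store.nat_setNat, show ¬ (1 : ℕ) = 4 by decide, false_and, if_false, NExpr.eval,
        hπ7, ← hc, hπa 1 (by decide) (by decide) (by decide), true_and]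
    · intro i hi
      rw [if_neg (fun h => by rw [Fin.ext h] at hi; omega)]
      exact hzero i (by omega)
    · have hother : ∀ j : Fin n, j ≠ v → (if (j : ℕ) = v then c else τ.nat 1 j) = τ.nat 1 j :=
        fun j hj => if_neg fun h => hj (Fin.ext h)
      have hlong : ∀ i, n ≤ L.rank i + (k + 1) → ∀ j, L.rank i < L.rank j →
          (if (j : ℕ) = v then c else τ.nat 1 j) = τ.nat 1 j := by
        intro i hi j hj
        exact hother j (by rintro rfl; omega)
      intro i hi
      unfold IsSelected
      simp only
      rw [show (∀ j : Fin n, L.rank i < L.rank j → (if (j : ℕ) = v then c else τ.nat 1 j) = 1 →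
          L.Indep (fun x => γ * tlog α m x) i j) ↔ ∀ j : Fin n, L.rank i < L.rank j →
          τ.nat 1 j = 1 → L.Indep (fun x => γ * tlog α m x) i j from
        forall_congr' fun j => forall_congr' fun hj => by rw [hlong i hi j hj]]
      by_cases hiv : i = v
      · subst hiv
        rw [if_pos rfl, hciff]
      · have hne := L.rank_injective.ne hiv
        rw [hother i hiv]
        exact hsel i (by omega)
  · rintro τ ⟨-, -, -, h⟩ i
    exact h i (by omega)

theorem wp_capProg (hm : m < α) (hγ : 0 ≤ γ) :
    WP n capProg (L.input w α m γ) fun τ => ∃ b : Fin n → ℝ,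
      (∀ i, L.IsResidual (fun x => γ * tlog α m x) w b i) ∧
      ∀ i, L.IsSelected (fun x => γ * tlog α m x) b (τ.output n) i := by
  refine WP.seq ((wp_sortProg (L.hasInput_input w α m γ)).mono ?_)
  rintro σ ⟨hord, hr, hfr⟩
  have hσ : L.HasOrder w α m γ σ :=
    ⟨(L.hasInput_input w α m γ).congr (hfr 0 (by decide)) fun a _ => by rw [hr], hord⟩
  refine WP.seq ((wp_residualProg hm hγ hσ fun i => by rw [hr]; simp [input]).mono ?_)
  rintro τ ⟨hτ, hτ1, hres⟩
  refine (wp_selectProg hm hγ hτ fun i => ?_).mono fun ρ hρ => ⟨_, hres, hρ⟩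
  rw [hτ1, hfr 1 (by decide)]
  simp [input]

end Links

/-! ### Approximation guarantees of first fit and local ratio. -/

theorem Finset.card_le_of_fibers {ι : Type*} (S : Finset ι) {k D : ℕ} (d : ι → Fin k)
    (h : ∀ a, (S.filter fun i => d i = a).card ≤ D) : S.card ≤ D * k := by
  rw [Finset.card_eq_sum_card_fiberwise (f := d) (t := Finset.univ) (fun _ _ => by simp)]
  refine (Finset.sum_le_card_nsmul _ _ D fun a _ => h a).trans ?_
  simp [mul_comm]

namespace Links

variable {X : Type*} [MetricSpace X] {n : ℕ} {L : Links X n} {f : ℝ → ℝ}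

/-- Independent sets of longer neighbours have at most `D` elements. -/
def LongerIndepLE (L : Links X n) (f : ℝ → ℝ) (D : ℕ) : Prop :=
  ∀ (i : Fin n) (J : Finset (Fin n)),
    (∀ j ∈ J, L.rank i < L.rank j ∧ ¬ L.Indep f i j) →
    (∀ j ∈ J, ∀ k ∈ J, j ≠ k → L.Indep f j k) → J.card ≤ D

theorem ne_of_forall_isFirstFit {c : Fin n → ℕ} (hc : ∀ i, L.IsFirstFit f c i) {i j : Fin n}
    (hij : i ≠ j) (h : ¬ L.Indep f i j) : c i ≠ c j := by
  rcases lt_or_gt_of_ne (L.rank_injective.ne hij) with hlt | hlt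
  · exact (hc i).2.1 j hlt h
  · exact ((hc j).2.1 i hlt (by rwa [L.indep_comm])).symm

/-- In a proper `k`-colouring, each class contains at most `D` longer neighbours of `i`, so `i` has
at most `D * k` of them and first fit stays within `D * k + 1` colours. -/
theorem card_image_le_of_isFirstFit {D : ℕ} (hD : L.LongerIndepLE f D) {c : Fin n → ℕ}
    (hc : ∀ i, L.IsFirstFit f c i) {k : ℕ} (hk : (L.conflictGraph f).Colorable k) :
    (Finset.univ.image c).card ≤ (D + 1) * k := by
  classical
  obtain ⟨d⟩ := hk
  rcases isEmpty_or_nonempty (Fin n) with hn | ⟨⟨i₀⟩⟩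
  · simp [Finset.univ_eq_empty]
  have hk0 : 0 < k := (Nat.zero_le _).trans_lt (d i₀).2
  have hle : ∀ i, c i ≤ D * k + 1 := by
    intro i
    set J := Finset.univ.filter fun j => L.rank i < L.rank j ∧ ¬ L.Indep f i j with hJ
    have h1 : Finset.Ico 1 (c i) ⊆ J.image c := by
      intro b hb
      rw [Finset.mem_Ico] at hb
      obtain ⟨j, h1, h2, h3⟩ := (hc i).2.2 b hb.1 hb.2
      exact Finset.mem_image.2 ⟨j, by simp [hJ, h1, h2], h3⟩
    have h2 := (Finset.card_le_card h1).trans Finset.card_image_le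
    have h3 : J.card ≤ D * k := by
      refine J.card_le_of_fibers d fun a => hD i _ (fun j hj => ?_) fun j hj l hl hjl => ?_
      · simpa [hJ] using (Finset.mem_filter.1 hj).1
      · by_contra hadj
        exact d.valid (v := j) (w := l) ⟨hjl, hadj⟩
          ((Finset.mem_filter.1 hj).2.trans (Finset.mem_filter.1 hl).2.symm)
    rw [Nat.card_Ico] at h2
    omega
  have hsub : Finset.univ.image c ⊆ Finset.Icc 1 (D * k + 1) := by
    intro b hb
    obtain ⟨i, -, rfl⟩ := Finset.mem_image.1 hb
    exact Finset.mem_Icc.2 ⟨(hc i).1, hle i⟩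
  have := Finset.card_le_card hsub
  rw [Nat.card_Icc] at this
  rw [add_mul, one_mul]
  omega

theorem card_image_le_chromaticNumber {D : ℕ} (hD : L.LongerIndepLE f D) {c : Fin n → ℕ}
    (hc : ∀ i, L.IsFirstFit f c i) :
    ((Finset.univ.image c).card : ℕ∞) ≤ (D + 1 : ℕ) * (L.conflictGraph f).chromaticNumber := by
  have hcol := (L.conflictGraph f).colorable_of_fintype
  have hne : (L.conflictGraph f).chromaticNumber ≠ ⊤ :=
    SimpleGraph.chromaticNumber_ne_top_iff_exists.2 ⟨_, hcol⟩
  have := card_image_le_of_isFirstFit hD hc (SimpleGraph.colorable_chromaticNumber hcol)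
  rw [← ENat.natCast_toNat hne]
  exact_mod_cast this

open scoped Classical in
-- Each weight is at most its own residual plus those of the shorter neighbours. When summing over
-- an independent `T`, a residual is charged once by its own link and at most `D` times by longer
-- neighbours.
theorem sum_le_of_isResidual {D : ℕ} (hD : L.LongerIndepLE f D) {w b : Fin n → ℝ}
    (hb : ∀ i, L.IsResidual f w b i) {T : Finset (Fin n)}
    (hT : ∀ i ∈ T, ∀ j ∈ T, i ≠ j → L.Indep f i j) : ∑ i ∈ T, w i ≤ (D + 1) * ∑ i, b i := by
  have hb0 : ∀ i, 0 ≤ b i := fun i => by rw [hb i]; exact le_max_left _ _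
  have h1 : ∀ i, w i ≤ b i + ∑ j, if L.rank j < L.rank i ∧ ¬ L.Indep f j i then b j else 0 := by
    intro i
    have := (le_max_right _ _).trans (hb i).ge
    linarith
  calc ∑ i ∈ T, w i ≤ ∑ i ∈ T, (b i +
        ∑ j, if L.rank j < L.rank i ∧ ¬ L.Indep f j i then b j else 0) :=
        Finset.sum_le_sum fun i _ => h1 i
    _ = ∑ i ∈ T, b i +
        ∑ j, ∑ i ∈ T, if L.rank j < L.rank i ∧ ¬ L.Indep f j i then b j else 0 := by
        rw [Finset.sum_add_distrib, Finset.sum_comm]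
    _ ≤ ∑ i, b i + ∑ j, D * b j := by
        refine add_le_add (Finset.sum_le_univ_sum_of_nonneg hb0)
          (Finset.sum_le_sum fun j _ => ?_)
        rw [← Finset.sum_filter, Finset.sum_const, nsmul_eq_mul]
        refine mul_le_mul_of_nonneg_right ?_ (hb0 j)
        exact_mod_cast hD j _ (fun i hi => (Finset.mem_filter.1 hi).2) fun i hi k hk =>
          hT i (Finset.mem_filter.1 hi).1 k (Finset.mem_filter.1 hk).1
    _ = _ := by rw [← Finset.mul_sum]; ring

/-- A link with positive residual is selected or has a longer selected neighbour, so its residual is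
charged to some selected link. The residual of a selected link is positive, hence not truncated, and
its weight equals exactly the largest total that can be charged to it. -/
theorem sum_residual_le {w b : Fin n → ℝ} (hb : ∀ i, L.IsResidual f w b i) {o : Fin n → ℕ}
    (ho : ∀ i, L.IsSelected f b o i) : ∑ i, b i ≤ ∑ i with o i = 1, w i := by
  classical
  have hb0 : ∀ i, 0 ≤ b i := fun i => by rw [hb i]; exact le_max_left _ _
  calc ∑ j, b j ≤ ∑ j, ∑ i with o i = 1,
        ((if j = i then b j else 0) +
          if L.rank j < L.rank i ∧ ¬ L.Indep f j i then b j else 0) := by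
        refine Finset.sum_le_sum fun j _ => ?_
        have hnn : ∀ i ∈ Finset.univ.filter fun i => o i = 1,
            0 ≤ (if j = i then b j else 0) +
              if L.rank j < L.rank i ∧ ¬ L.Indep f j i then b j else 0 := fun i _ =>
          add_nonneg (by split_ifs <;> simp [hb0 j]) (by split_ifs <;> simp [hb0 j])
        rcases (hb0 j).eq_or_lt with hj | hj
        · rw [← hj]
          exact Finset.sum_nonneg fun i _ => by simp
        · by_cases hoj : o j = 1
          · refine le_trans ?_ (Finset.single_le_sum hnn (by simpa using hoj : j ∈ _))
            simp
          · have := mt (ho j).2 hoj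
            push Not at this
            obtain ⟨i, hi, hoi, hadj⟩ := this hj
            refine le_trans ?_ (Finset.single_le_sum hnn (by simpa using hoi : i ∈ _))
            have hji : j ≠ i := by rintro rfl; exact hi.ne rfl
            simp [hi, hadj, hji]
    _ = ∑ i with o i = 1, (b i +
          ∑ j, if L.rank j < L.rank i ∧ ¬ L.Indep f j i then b j else 0) := by
        rw [Finset.sum_comm]
        refine Finset.sum_congr rfl fun i _ => ?_
        rw [Finset.sum_add_distrib]
        simp
    _ = ∑ i with o i = 1, w i := by
        refine Finset.sum_congr rfl fun i hi => ?_
        have h1 := ((ho i).1 (Finset.mem_filter.1 hi).2).1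
        have h2 := hb i
        unfold IsResidual at h2
        rcases max_choice 0 (w i - ∑ j, if L.rank j < L.rank i ∧ ¬ L.Indep f j i then b j else 0)
          with h | h
        · rw [h] at h2; linarith
        · rw [h] at h2; linarith

theorem indep_of_isSelected {b : Fin n → ℝ} {o : Fin n → ℕ} (ho : ∀ i, L.IsSelected f b o i)
    {i j : Fin n} (hi : o i = 1) (hj : o j = 1) (hij : i ≠ j) : L.Indep f i j := by
  rcases lt_or_gt_of_ne (L.rank_injective.ne hij) with hlt | hlt
  · exact ((ho i).1 hi).2 j hlt hj
  · rw [L.indep_comm]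
    exact ((ho j).1 hj).2 i hlt hi

end Links

/-! ### Assembling the theorem. -/

theorem mainTheorem1 :
    ∃ (schedProg capProg : RealRAM.Program) (time : Polynomial ℕ),
      ∀ (α β m : ℝ) (C : ℝ → ℝ), 2 < α → α < 6 → 0 < β → 0 ≤ m → m < α →
        ∃ (γ : ℝ) (K : ℕ), 1 ≤ γ ∧
          ∀ (X : Type*) [MetricSpace X], DoublingDimLE X m C →
          ∀ (N : ℝ), 0 ≤ N → ∀ (n : ℕ) (L : Links X n),
            -- Scheduling
            (∃ (τ : RealRAM.Store) (t : ℕ),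
              RealRAM.Run schedProg (L.input 0 α m γ) τ t ∧ t ≤ time.eval n ∧
              (∀ i j, (L.conflictGraph fun x => γ * tlog α m x).Adj i j →
                τ.output n i ≠ τ.output n j) ∧
              ((Finset.univ.image (τ.output n)).card : ℕ∞) ≤
                K * (L.conflictGraph fun x => γ * tlog α m x).chromaticNumber ∧
              L.IsSchedule α β N (τ.output n) ∧
              (Finset.univ.image (τ.output n)).card ≤ K * logStar L.ratio * L.optS α β N) ∧
            -- Weighted capacity
            (∀ w : Fin n → ℝ, (∀ i, 0 < w i) →
              ∃ (τ : RealRAM.Store) (t : ℕ) (S : Finset (Fin n)),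
                RealRAM.Run capProg (L.input w α m γ) τ t ∧ t ≤ time.eval n ∧
                (∀ i, i ∈ S ↔ τ.output n i = 1) ∧
                (L.conflictGraph fun x => γ * tlog α m x).IsIndepSet S ∧
                (∀ T : Finset (Fin n),
                  (L.conflictGraph fun x => γ * tlog α m x).IsIndepSet T →
                  ∑ i ∈ T, w i ≤ K * ∑ i ∈ S, w i) ∧
                L.Feasible α β N S ∧
                (∀ T : Finset (Fin n), L.Feasible α β N T →
                  ∑ i ∈ T, w i ≤ K * logStar L.ratio * ∑ i ∈ S, w i)) := by
  classical
  open Links RealRAM in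
  refine ⟨Links.schedProg, Links.capProg,
    Links.schedProg.boundPoly + Links.capProg.boundPoly, ?_⟩
  intro α β m C hα2 _ hβ hm0 hm
  have hα : 0 < α := by linarith
  -- The midpoint of `m` and `(α + m) / 2`: above `m` for the doubling bound, below `(α + m) / 2`
  -- for summability. `γ` is fixed next; `D` and `K` depend on it.
  set δ := (3 * m + α) / 4 with hδ
  obtain ⟨γ, hγ, hfeas⟩ := exists_feasible_of_indep (C := C δ) (δ := δ) hα hβ hm
    (by rw [hδ]; linarith)
  obtain ⟨D, hD⟩ := exists_card_indep_longer_le (C := C δ) (δ := δ) hm hγ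
  obtain ⟨K, hK⟩ := exists_coloring_of_feasible (C := C δ) (δ := δ) hα hβ hm hγ
  have hγ0 : 0 ≤ γ := by linarith
  -- `K + 1` instead of `K`, so that the one constant also dominates the bare factor `D + 1` in the
  -- comparisons inside the conflict graph.
  refine ⟨γ, (D + 1) * (K + 1), hγ, fun X _ hX N hN n L => ?_⟩
  have hXδ : DoublingBound X (C δ) δ := hX δ (by rw [hδ]; linarith)
  set f : ℝ → ℝ := fun x => γ * tlog α m x with hf
  have hDL : L.LongerIndepLE f D := fun i J hJ hind => hD X hXδ n L i J
    (fun j hj => ⟨L.len_le_of_rank_lt (hJ j hj).1, (hJ j hj).2⟩) hind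
  have hle : ∀ k l : ℕ, (D + 1) * (k * (K * l)) ≤ (D + 1) * (K + 1) * l * k := by
    intro k l
    calc (D + 1) * (k * (K * l)) = (D + 1) * K * l * k := by ring
      _ ≤ _ := by gcongr; omega
  constructor
  · obtain ⟨τ, t, hrun, ht, hfit⟩ := wp_schedProg (L := L) (w := 0) (α := α) (m := m) (γ := γ)
      hm hγ0
    refine ⟨τ, t, hrun, ?_, fun i j hadj => ne_of_forall_isFirstFit hfit hadj.1 hadj.2, ?_, ?_, ?_⟩
    · rw [Polynomial.eval_add, Program.eval_boundPoly]
      omega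
    · refine (card_image_le_chromaticNumber hDL hfit).trans (mul_le_mul_left ?_ _)
      exact_mod_cast Nat.le_mul_of_pos_right _ (Nat.succ_pos K)
    · intro k
      refine hfeas X hXδ N hN n L _ fun i hi j hj hij => ?_
      by_contra hadj
      exact ne_of_forall_isFirstFit hfit hij hadj
        ((Finset.mem_filter.1 hi).2.trans (Finset.mem_filter.1 hj).2.symm)
    · obtain ⟨s, hs⟩ : ∃ c : Fin n → Fin (L.optS α β N), L.IsSchedule α β N c := by
        -- The infimum defining `optS` is attained: a separate slot for each link is a schedule,
        -- singletons being independent.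
        refine Nat.sInf_mem (s := {k : ℕ | ∃ c : Fin n → Fin k, L.IsSchedule α β N c})
          ⟨n, id, fun k => hfeas X hXδ N hN n L _ fun i hi j hj hij => ?_⟩
        exact absurd ((Finset.mem_filter.1 hi).2.trans (Finset.mem_filter.1 hj).2.symm) hij
      choose c hc using fun k => hK X hXδ N hN n L _ (hs k)
      have hcol : (L.conflictGraph f).Colorable (L.optS α β N * (K * logStar L.ratio)) := by
        refine ⟨SimpleGraph.Coloring.mk (fun i => finProdFinEquiv (s i, c (s i) i)) ?_⟩
        intro i j hadj heq
        have heq := finProdFinEquiv.injective heq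
        rw [Prod.mk.injEq] at heq
        obtain ⟨h1, h2⟩ := heq
        rw [← h1] at h2
        exact hc (s i) i (by simp) j (by simp [h1]) hadj.1 hadj.2 h2
      exact (card_image_le_of_isFirstFit hDL hfit hcol).trans (hle _ _)
  · intro w hw
    obtain ⟨τ, t, hrun, ht, b, hb, ho⟩ := wp_capProg (L := L) (w := w) (α := α) (m := m) (γ := γ)
      hm hγ0
    have hS0 : 0 ≤ ∑ i with τ.output n i = 1, w i := Finset.sum_nonneg fun i _ => (hw i).le
    have hT : ∀ T : Finset (Fin n), (∀ i ∈ T, ∀ j ∈ T, i ≠ j → L.Indep f i j) →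
        ∑ i ∈ T, w i ≤ (D + 1) * ∑ i with τ.output n i = 1, w i := fun T hT =>
      (sum_le_of_isResidual hDL hb hT).trans
        (mul_le_mul_of_nonneg_left (sum_residual_le hb ho) (by positivity))
    have hSind : ∀ i ∈ Finset.univ.filter fun i => τ.output n i = 1,
        ∀ j ∈ Finset.univ.filter fun i => τ.output n i = 1, i ≠ j → L.Indep f i j :=
      fun i hi j hj hij =>
        indep_of_isSelected ho (Finset.mem_filter.1 hi).2 (Finset.mem_filter.1 hj).2 hij
    refine ⟨τ, t, Finset.univ.filter fun i => τ.output n i = 1, hrun, ?_, fun i => by simp,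
      ?_, fun T hTi => ?_, ?_, fun T hTf => ?_⟩
    · rw [Polynomial.eval_add, Program.eval_boundPoly, Program.eval_boundPoly]
      omega
    · intro i hi j hj hij hadj
      exact hadj.2 (hSind i hi j hj hij)
    · refine (hT T fun i hi j hj hij => ?_).trans (mul_le_mul_of_nonneg_right ?_ hS0)
      · by_contra hadj
        exact hTi hi hj hij ⟨hij, hadj⟩
      · push_cast
        exact le_mul_of_one_le_right (by positivity) (by linarith [(Nat.cast_nonneg K : (0:ℝ) ≤ K)])
    · exact hfeas X hXδ N hN n L _ hSind
    · obtain ⟨c, hc⟩ := hK X hXδ N hN n L T hTf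
      -- A feasible `T` splits into `K * logStar` independent classes, each of weight at most `D +
      -- 1` times that of the selected set.
      calc ∑ i ∈ T, w i = ∑ a, ∑ i ∈ T with c i = a, w i :=
            (Finset.sum_fiberwise T c w).symm
        _ ≤ ∑ _a : Fin (K * logStar L.ratio),
              (D + 1) * ∑ i with τ.output n i = 1, w i := by
            refine Finset.sum_le_sum fun a _ => hT _ fun i hi j hj hij => ?_
            obtain ⟨hi, hia⟩ := Finset.mem_filter.1 hi
            obtain ⟨hj, hja⟩ := Finset.mem_filter.1 hj
            by_contra hadj
            exact hc i hi j hj hij hadj (hia.trans hja.symm)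
        _ = ((D + 1) * (1 * (K * logStar L.ratio)) : ℕ) *
              ∑ i with τ.output n i = 1, w i := by
            rw [Finset.sum_const, Finset.card_univ, Fintype.card_fin, nsmul_eq_mul]
            push_cast
            ring
        _ ≤ ((D + 1) * (K + 1) * logStar L.ratio * 1 : ℕ) *
              ∑ i with τ.output n i = 1, w i := by
            refine mul_le_mul_of_nonneg_right ?_ hS0
            exact_mod_cast hle 1 (logStar L.ratio)
        _ = _ := by push_cast; ring
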